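/- Let $\kappa>0$, let $d\in\mathbb R^3$ with $|d|=1$, and let $u_{\rm inc}(x)=e^{i\kappa\langle d,x\rangle}$. Let $(\Omega,\mathcal F,\mathbb P)$ be a probability space, let $D(\omega)\subset\mathbb R^3$, $\omega\in\Omega$, be a random obstacle which almost surely is a bounded open set with Lipschitz boundary, and let $u_{\rm s}(\cdot,\omega)$ be the scattered wave of $u_{\rm inc}$ at the sound-soft obstacle $D(\omega)$. That is, almost surely the total wave $u=u_{\rm inc}+u_{\rm s}$ is $C^2$ in $\mathbb R^3\setminus\overline{D(\omega)}$ and continuous on $\mathbb R^3\setminus D(\omega)$, and $$\Delta u+\kappa^2u=0\ \text{ in }\mathbb R^3\setminus\overline{D(\omega)},\qquad u=0\ \text{ on }\partial D(\omega),\qquad r\Big(\frac{\partial u_{\rm s}}{\partial r}-i\kappa u_{\rm s}\Big)\to0\ \text{ as } r=|x|\to\infty,$$ the last limit being uniform in all directions. Let $T=\partial B$ be the boundary of a fixed bounded open set $B\subset\mathbb R^3$ with Lipschitz boundary that almost surely encloses the obstacle, $\overline{D(\omega)}\subset B$. Let $\sigma$ be the surface measure on $T$ and $n$ the outward unit normal.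 Assume that the Cauchy data $u_{\rm s}|_T$ and $\frac{\partial u_{\rm s}}{\partial n}|_T$ belong to $L^2(\Omega\times T,\mathbb P\otimes\sigma)$. Put $$\Phi(x,z)=\frac{e^{i\kappa|x-z|}}{4\pi|x-z|},\qquad \operatorname{Cor}[X,Y](z,z')=\mathbb E\big[X(z)\,\overline{Y(z')}\big],\qquad \operatorname{Cor}[X]=\operatorname{Cor}[X,X].$$ Then for all $x,x'\in\mathbb R^3\setminus\overline B$, that is, for all points outside the interface, the random variables $u_{\rm s}(x)$ and $u_{\rm s}(x')$ have finite second moments, the integrands below are integrable over $T$ and over $T\times T$, respectively, and $$\mathbb E[u_{\rm s}](x)=\int_T\Big\{\frac{\partial\Phi(x,z)}{\partial n_z}\,\mathbb E[u_{\rm s}](z)-\Phi(x,z)\,\mathbb E\Big[\frac{\partial u_{\rm s}}{\partial n}\Big](z)\Big\}\,d\sigma_z,$$ $$\begin{aligned}\operatorname{Cor}[u_{\rm s}](x,x')=\int_T\int_T\Big\{&\Phi(x,z)\overline{\Phi(x',z')}\operatorname{Cor}\Big[\frac{\partial u_{\rm s}}{\partial n}\Big](z,z')-\Phi(x,z)\overline{\frac{\partial\Phi(x',z')}{\partial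 n_{z'}}}\operatorname{Cor}\Big[\frac{\partial u_{\rm s}}{\partial n},u_{\rm s}\Big](z,z')\\&-\frac{\partial\Phi(x,z)}{\partial n_z}\overline{\Phi(x',z')}\operatorname{Cor}\Big[u_{\rm s},\frac{\partial u_{\rm s}}{\partial n}\Big](z,z')+\frac{\partial\Phi(x,z)}{\partial n_z}\overline{\frac{\partial\Phi(x',z')}{\partial n_{z'}}}\operatorname{Cor}[u_{\rm s}](z,z')\Big\}\,d\sigma_{z'}\,d\sigma_z.\end{aligned}$$ Moreover, the covariance $\operatorname{Cov}[u_{\rm s}](x,x')=\mathbb E\big[(u_{\rm s}(x)-\mathbb E[u_{\rm s}](x))\overline{(u_{\rm s}(x')-\mathbb E[u_{\rm s}](x'))}\big]$ equals $\operatorname{Cor}[u_{\rm s}](x,x')-\mathbb E[u_{\rm s}](x)\overline{\mathbb E[u_{\rm s}](x')}$, and the variance $\mathbb V[u_{\rm s}](x)=\mathbb E\big[|u_{\rm s}(x)-\mathbb E[u_{\rm s}](x)|^2\big]$ satisfies $$\mathbb V[u_{\rm s}](x)=\operatorname{Cov}[u_{\rm s}](x,x)=\operatorname{Cor}[u_{\rm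 s}](x,x)-|\mathbb E[u_{\rm s}](x)|^2.$$ -/

import Mathlib

open MeasureTheory
open scoped InnerProductSpace ComplexConjugate

noncomputable section

namespace RandomScattering

/-- Three-dimensional Euclidean space. -/
abbrev E3 : Type := EuclideanSpace ℝ (Fin 3)

/-! ### Lipschitz domains, surface measure, outward normal -/

/-- A bounded open set `B ⊆ ℝ³` with Lipschitz boundary: near each boundary point `z`, in a
direction `e`, the set `B` is the strict subgraph of a Lipschitz function of the component
`y - ⟪e, y⟫ e` of `y` orthogonal to `e`. -/
structure IsLipschitzDomain (B : Set E3) : Prop where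
  isOpen : IsOpen B
  isBounded : Bornology.IsBounded B
  exists_graph : ∀ z ∈ frontier B, ∃ (e : E3) (g : E3 → ℝ) (L : NNReal) (r : ℝ),
    ‖e‖ = 1 ∧ LipschitzWith L g ∧ 0 < r ∧
      ∀ y ∈ Metric.ball z r, y ∈ B ↔ ⟪e, y⟫_ℝ < g (y - ⟪e, y⟫_ℝ • e)

/-- The surface measure on `∂B`: the two-dimensional Hausdorff measure, normalised so that it is
the area on planes, restricted to `∂B`. -/
def surfaceMeasure (B : Set E3) : Measure E3 :=
  (Measure.euclideanHausdorffMeasure 2 : Measure E3).restrict (frontier B)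

/-- `ν` is the outward unit normal of `B` at `z`: outside every double cone around the plane
`z + ν^⊥`, the set `B` coincides near `z` with the half-space on the side of `-ν`. -/
def IsOuterUnitNormal (B : Set E3) (z ν : E3) : Prop :=
  ‖ν‖ = 1 ∧ ∀ ε > 0, ∃ δ > 0, ∀ y ∈ Metric.ball z δ,
    (⟪y - z, ν⟫_ℝ < -ε * ‖y - z‖ → y ∈ B) ∧ (ε * ‖y - z‖ < ⟪y - z, ν⟫_ℝ → y ∉ B)

theorem IsOuterUnitNormal.unique {B : Set E3} {z ν ν' : E3} (h : IsOuterUnitNormal B z ν)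
    (h' : IsOuterUnitNormal B z ν') : ν = ν' := by
  by_contra hne
  have hv : 0 < ‖ν' - ν‖ := norm_pos_iff.2 (sub_ne_zero.2 (Ne.symm hne))
  have e1 : ‖ν' - ν‖ ^ 2 = 2 - 2 * ⟪ν', ν⟫_ℝ := by
    rw [norm_sub_sq_real, h.1, h'.1]; ring
  have e2 : ⟪ν' - ν, ν⟫_ℝ = -(‖ν' - ν‖ ^ 2 / 2) := by
    rw [e1, inner_sub_left, real_inner_self_eq_norm_sq, h.1]; ring
  have e3 : ⟪ν' - ν, ν'⟫_ℝ = ‖ν' - ν‖ ^ 2 / 2 := by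
    rw [e1, inner_sub_left, real_inner_self_eq_norm_sq, h'.1, real_inner_comm]; ring
  obtain ⟨δ, hδ, H⟩ := h.2 (‖ν' - ν‖ / 4) (by positivity)
  obtain ⟨δ', hδ', H'⟩ := h'.2 (‖ν' - ν‖ / 4) (by positivity)
  obtain ⟨m, hm, hmδ, hmδ'⟩ : ∃ m : ℝ, 0 < m ∧ m < δ ∧ m < δ' := by
    refine ⟨min δ δ' / 2, by positivity, ?_, ?_⟩
    · have := min_le_left δ δ'; linarith
    · have := min_le_right δ δ'; linarith
  set t : ℝ := m / ‖ν' - ν‖ with ht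
  have htpos : 0 < t := by positivity
  have htv : t * ‖ν' - ν‖ = m := by rw [ht]; field_simp
  have hnorm : ‖t • (ν' - ν)‖ = t * ‖ν' - ν‖ := by
    rw [norm_smul, Real.norm_of_nonneg htpos.le]
  have hy : z + t • (ν' - ν) - z = t • (ν' - ν) := by abel
  have hpos : 0 < t * ‖ν' - ν‖ ^ 2 := by positivity
  have A := (H (z + t • (ν' - ν)) (by
    rw [mem_ball_iff_norm, hy, hnorm, htv]; exact hmδ)).1 (by
    rw [hy, hnorm, real_inner_smul_left, e2]; nlinarith)
  exact (H' (z + t • (ν' - ν)) (by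
    rw [mem_ball_iff_norm, hy, hnorm, htv]; exact hmδ')).2 (by
    rw [hy, hnorm, real_inner_smul_left, e3]; nlinarith) A

open Classical in
/-- The outward unit normal field on `∂B`; the value at points without a normal is `0`. -/
def outerNormal (B : Set E3) (z : E3) : E3 :=
  if h : ∃ ν, IsOuterUnitNormal B z ν then h.choose else 0

/-- The derivative of `f` at `z` in the direction of the outward unit normal of `B`. -/
def normalDeriv (B : Set E3) (f : E3 → ℂ) (z : E3) : ℂ :=
  fderiv ℝ f z (outerNormal B z)

/-! ### The scattering problem -/

/-- The outgoing fundamental solution `Φ(x, z) = exp(iκ|x - z|) / (4π|x - z|)`. -/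
def greenFun (κ : ℝ) (x z : E3) : ℂ :=
  Complex.exp (Complex.I * (κ * ‖x - z‖ : ℝ)) / (4 * Real.pi * ‖x - z‖ : ℝ)

/-- The kernel `∂Φ(x, z)/∂n_z` for `z ∈ ∂B`. -/
def greenNormal (κ : ℝ) (B : Set E3) (x z : E3) : ℂ :=
  normalDeriv B (fun w => greenFun κ x w) z

/-- The incident plane wave `exp(iκ⟨d, x⟩)`. -/
def planeWave (κ : ℝ) (d x : E3) : ℂ :=
  Complex.exp (Complex.I * (κ * ⟪d, x⟫_ℝ : ℝ))

/-- `us` is the scattered wave of the incident plane wave with wavenumber `κ` and direction `d`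
at the sound-soft obstacle `D` (values of `us` inside `D` are irrelevant): the total wave
`u = u_inc + us` is a classical solution of the exterior Dirichlet problem for the Helmholtz
equation, and `us` satisfies Sommerfeld's radiation condition uniformly in all directions. -/
structure IsScatteredWave (κ : ℝ) (d : E3) (D : Set E3) (us : E3 → ℂ) : Prop where
  contDiffOn : ContDiffOn ℝ 2 (fun x => planeWave κ d x + us x) (closure D)ᶜ
  helmholtz : ∀ x ∈ (closure D)ᶜ,
    Laplacian.laplacian (fun x => planeWave κ d x + us x) x +
      (κ : ℂ) ^ 2 * (planeWave κ d x + us x) = 0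
  continuousOn : ContinuousOn (fun x => planeWave κ d x + us x) Dᶜ
  soundSoft : ∀ x ∈ frontier D, planeWave κ d x + us x = 0
  radiation : Filter.Tendsto
    (fun x : E3 => (‖x‖ : ℂ) * (fderiv ℝ us x (‖x‖⁻¹ • x) - Complex.I * κ * us x))
    (Bornology.cobounded E3) (nhds 0)

/-! ### Moments of complex random fields -/

section Moments

variable {Ω : Type*} [MeasurableSpace Ω]

/-- The mean `𝔼[X](x)`. -/
def mean (P : Measure Ω) (X : Ω → E3 → ℂ) (x : E3) : ℂ :=
  ∫ ω, X ω x ∂P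

/-- The correlation `Cor[X, Y](x, x') = 𝔼[X(x) conj(Y(x'))]`. -/
def cor (P : Measure Ω) (X Y : Ω → E3 → ℂ) (x x' : E3) : ℂ :=
  ∫ ω, X ω x * conj (Y ω x') ∂P

/-- The covariance `Cov[X](x, x')`. -/
def cov (P : Measure Ω) (X : Ω → E3 → ℂ) (x x' : E3) : ℂ :=
  ∫ ω, (X ω x - mean P X x) * conj (X ω x' - mean P X x') ∂P

/-- The variance `𝕍[X](x) = 𝔼[|X(x) - 𝔼[X](x)|²]`. -/
def var (P : Measure Ω) (X : Ω → E3 → ℂ) (x : E3) : ℝ :=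
  ∫ ω, ‖X ω x - mean P X x‖ ^ 2 ∂P

end Moments

/-- The integrand of the boundary integral over `∂B` for the mean at `x`. -/
def meanIntegrand {Ω : Type*} [MeasurableSpace Ω] (κ : ℝ) (B : Set E3) (P : Measure Ω)
    (us : Ω → E3 → ℂ) (x z : E3) : ℂ :=
  greenNormal κ B x z * mean P us z
    - greenFun κ x z * mean P (fun ω => normalDeriv B (us ω)) z

/-- The integrand of the double boundary integral over `∂B × ∂B` for the correlation at
`(x, x')`. -/
def corIntegrand {Ω : Type*} [MeasurableSpace Ω] (κ : ℝ) (B : Set E3) (P : Measure Ω)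
    (us : Ω → E3 → ℂ) (x x' z z' : E3) : ℂ :=
  greenFun κ x z * conj (greenFun κ x' z') *
      cor P (fun ω => normalDeriv B (us ω)) (fun ω => normalDeriv B (us ω)) z z'
    - greenFun κ x z * conj (greenNormal κ B x' z') *
      cor P (fun ω => normalDeriv B (us ω)) us z z'
    - greenNormal κ B x z * conj (greenFun κ x' z') *
      cor P us (fun ω => normalDeriv B (us ω)) z z'
    + greenNormal κ B x z * conj (greenNormal κ B x' z') *
      cor P us us z z'

end RandomScattering

end

noncomputable section

namespace RandomScattering

open Set Filter Topology
open scoped NNReal ENNReal Gradient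

/-!
For a pole `x` outside `closure B`, both `Φ(x, ·)` and a radiating wave `u` solve the Helmholtz
equation off compact sets, so Green's flux field `u ∇Φ - Φ ∇u` is divergence free away from the
obstacle and from `x`. Testing its divergence against smooth radial cutoffs, which replace the
small sphere around `x` and the large sphere, expresses the flux through `∂B` by two shell
integrals. The one around `x` tends to `u x` because of the `1 / (4π|x - z|)` singularity. The far
one tends to `0`: conservation of the energy flux `Im (ū ∂u/∂r)` and the radiation condition bound
the `L²` norm of `u` on large spheres, and the flux pairs the waves with the `o(1/r)` radiation
defects of one another. The divergence theorem up to the Lipschitz boundary is reduced by a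
partition of unity to subgraphs of Lipschitz functions, where it is Fubini and the one-dimensional
fundamental theorem of calculus.

The random wave is thereby a fixed linear functional of its Cauchy data in `L²(Ω × ∂B)`, and moments
commute with it by Fubini.
-/

section Frame

variable {V E : Type*} [NormedAddCommGroup V] [InnerProductSpace ℝ V]
  [NormedAddCommGroup E] [InnerProductSpace ℝ E]

/-- The orthonormal coordinates `(p, t)` on `E` given by `Ψ`, with horizontal space `V` and vertical
axis `Ψ (0, 1)`. They are defined on `V × ℝ`, whose volume is a product measure, but whose norm is
not the Euclidean one. -/
def frameMap (Ψ : WithLp 2 (V × ℝ) ≃ₗᵢ[ℝ] E) : (V × ℝ) ≃L[ℝ] E :=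
  (WithLp.prodContinuousLinearEquiv 2 ℝ V ℝ).symm.trans Ψ.toContinuousLinearEquiv

variable (Ψ : WithLp 2 (V × ℝ) ≃ₗᵢ[ℝ] E)

theorem inner_frameMap (a b : V × ℝ) :
    ⟪frameMap Ψ a, frameMap Ψ b⟫_ℝ = ⟪a.1, b.1⟫_ℝ + a.2 * b.2 := by
  simp [frameMap, WithLp.prod_inner_apply, mul_comm]

theorem norm_frameMap_sq (a : V × ℝ) : ‖frameMap Ψ a‖ ^ 2 = ‖a.1‖ ^ 2 + a.2 ^ 2 := by
  rw [← real_inner_self_eq_norm_sq, inner_frameMap, real_inner_self_eq_norm_sq, sq a.2]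

theorem norm_fst_le_norm_frameMap (a : V × ℝ) : ‖a.1‖ ≤ ‖frameMap Ψ a‖ :=
  le_of_sq_le_sq (by simpa [norm_frameMap_sq] using sq_nonneg a.2) (norm_nonneg _)

theorem norm_frameMap_horizontal (p : V) : ‖frameMap Ψ (p, 0)‖ = ‖p‖ :=
  (sq_eq_sq₀ (norm_nonneg _) (norm_nonneg _)).1 (by simp [norm_frameMap_sq])

theorem norm_frameMap_vertical (t : ℝ) : ‖frameMap Ψ (0, t)‖ = |t| :=
  (sq_eq_sq₀ (norm_nonneg _) (abs_nonneg _)).1 (by simp [norm_frameMap_sq])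

theorem inner_vertical_frameMap (a : V × ℝ) : ⟪frameMap Ψ (0, 1), frameMap Ψ a⟫_ℝ = a.2 := by
  simp [inner_frameMap]

theorem frameMap_eq_horizontal_add (a : V × ℝ) :
    frameMap Ψ a = frameMap Ψ (a.1, 0) + a.2 • frameMap Ψ (0, 1) := by
  rw [← map_smul, ← map_add]; simp

theorem exists_frame [FiniteDimensional ℝ V] [FiniteDimensional ℝ E]
    (hVE : Module.finrank ℝ V + 1 = Module.finrank ℝ E) {e : E} (he : ‖e‖ = 1) :
    ∃ Ψ : WithLp 2 (V × ℝ) ≃ₗᵢ[ℝ] E, frameMap Ψ (0, 1) = e := by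
  have hrank : Module.finrank ℝ (WithLp 2 (V × ℝ)) = Module.finrank ℝ E := by
    rw [(WithLp.linearEquiv 2 ℝ (V × ℝ)).finrank_eq]; simp [hVE]
  let Ψ₀ : WithLp 2 (V × ℝ) ≃ₗᵢ[ℝ] E :=
    (stdOrthonormalBasis ℝ _).equiv (stdOrthonormalBasis ℝ E) (finCongr hrank)
  let e₀ := frameMap Ψ₀ (0, 1)
  have he₀ : ‖e₀‖ = ‖e‖ := by simp [e₀, norm_frameMap_vertical, he]
  exact ⟨Ψ₀.trans ((ℝ ∙ (e₀ - e))ᗮ).reflection, Submodule.reflection_sub he₀⟩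

theorem measurePreserving_frameMap [FiniteDimensional ℝ V] [MeasurableSpace V] [BorelSpace V]
    [MeasurableSpace E] [BorelSpace E] [FiniteDimensional ℝ E] :
    MeasurePreserving (frameMap Ψ) volume volume :=
  Ψ.measurePreserving.comp (WithLp.volume_preserving_toLp V ℝ)

end Frame

section GraphDensity

variable {V : Type*} [NormedAddCommGroup V] [InnerProductSpace ℝ V]

/-- The surface element `√(1 + |A|²)` of a graph with slope `A`. -/
def graphDensity (A : V →L[ℝ] ℝ) : ℝ := √(1 + ‖A‖ ^ 2)

theorem graphDensity_sq (A : V →L[ℝ] ℝ) : graphDensity A ^ 2 = 1 + ‖A‖ ^ 2 :=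
  Real.sq_sqrt (by positivity)

theorem one_le_graphDensity (A : V →L[ℝ] ℝ) : 1 ≤ graphDensity A :=
  Real.one_le_sqrt.2 (by nlinarith [sq_nonneg ‖A‖])

theorem graphDensity_pos (A : V →L[ℝ] ℝ) : 0 < graphDensity A :=
  one_pos.trans_le (one_le_graphDensity A)

theorem norm_le_graphDensity (A : V →L[ℝ] ℝ) : ‖A‖ ≤ graphDensity A :=
  Real.le_sqrt_of_sq_le (by linarith)

theorem graphDensity_le_add (A A' : V →L[ℝ] ℝ) :
    graphDensity A ≤ graphDensity A' + ‖A - A'‖ := by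
  have hA : ‖A‖ ≤ ‖A - A'‖ + ‖A'‖ := by simpa using norm_add_le (A - A') A'
  have hA' := norm_le_graphDensity A'
  refine (Real.sqrt_le_left (add_nonneg (graphDensity_pos A').le (norm_nonneg _))).2 ?_
  calc 1 + ‖A‖ ^ 2 ≤ 1 + (‖A - A'‖ + ‖A'‖) ^ 2 := by gcongr
    _ = graphDensity A' ^ 2 + 2 * ‖A'‖ * ‖A - A'‖ + ‖A - A'‖ ^ 2 := by
        rw [graphDensity_sq]; ring
    _ ≤ graphDensity A' ^ 2 + 2 * graphDensity A' * ‖A - A'‖ + ‖A - A'‖ ^ 2 := by gcongr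
    _ = (graphDensity A' + ‖A - A'‖) ^ 2 := by ring

theorem graphDensity_le_mul {A A' : V →L[ℝ] ℝ} {δ : ℝ} (h : ‖A - A'‖ ≤ δ) :
    graphDensity A ≤ (1 + δ) * graphDensity A' := by
  have hδ := mul_le_mul h (one_le_graphDensity A') zero_le_one ((norm_nonneg _).trans h)
  linarith [graphDensity_le_add A A']

@[fun_prop]
theorem continuous_graphDensity : Continuous (graphDensity : (V →L[ℝ] ℝ) → ℝ) := by
  unfold graphDensity; fun_prop

theorem measurable_graphDensity_fderiv [MeasurableSpace V] [BorelSpace V] (γ : V → ℝ) :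
    Measurable fun p => ENNReal.ofReal (graphDensity (fderiv ℝ γ p)) :=
  (continuous_graphDensity.measurable.comp (measurable_fderiv ℝ γ)).ennreal_ofReal

theorem normDet_eq_graphDensity {E : Type*} [NormedAddCommGroup E] [InnerProductSpace ℝ E]
    [FiniteDimensional ℝ V] {T : V →ₗ[ℝ] E} {A : V →L[ℝ] ℝ}
    (hT : ∀ p q, ⟪T p, T q⟫_ℝ = ⟪p, q⟫_ℝ + A p * A q) : T.normDet = graphDensity A := by
  let b := stdOrthonormalBasis ℝ V
  have hgram : Matrix.gram ℝ (fun i => T (b i)) =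
      1 + Matrix.replicateCol Unit (fun i => A (b i)) *
        Matrix.replicateRow Unit (fun i => A (b i)) := by
    ext i j
    simp [Matrix.gram_apply, hT, b.inner_eq_ite, Matrix.one_apply, Matrix.mul_apply]
  have hnorm : ‖A‖ ^ 2 = ∑ i, A (b i) * A (b i) := by
    obtain ⟨w, rfl⟩ := (InnerProductSpace.toDual ℝ V).surjective A
    rw [LinearIsometryEquiv.norm_map, ← real_inner_self_eq_norm_sq, ← b.sum_inner_mul_inner]
    simp [real_inner_comm]
  have hdet : T.normDet ^ 2 = graphDensity A ^ 2 := by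
    have h := T.normDet_sq_eq_det_gram b
    rw [hgram, Matrix.det_one_add_replicateCol_mul_replicateRow] at h
    simpa [graphDensity_sq, hnorm, dotProduct] using h
  exact (sq_eq_sq₀ T.normDet_nonneg (graphDensity_pos A).le).1 hdet

end GraphDensity

section GraphMap

variable {V E : Type*} [NormedAddCommGroup V] [InnerProductSpace ℝ V]
  [NormedAddCommGroup E] [InnerProductSpace ℝ E]
  {Ψ : WithLp 2 (V × ℝ) ≃ₗᵢ[ℝ] E} {γ : V → ℝ} {L : ℝ≥0}

/-- The parametrisation of the graph of `γ` in the orthonormal coordinates `Ψ`. -/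
def graphMap (Ψ : WithLp 2 (V × ℝ) ≃ₗᵢ[ℝ] E) (γ : V → ℝ) (p : V) : E := frameMap Ψ (p, γ p)

theorem continuous_graphMap (hγ : Continuous γ) : Continuous (graphMap Ψ γ) := by
  unfold graphMap; fun_prop

theorem injective_graphMap : Function.Injective (graphMap Ψ γ) := fun _ _ h =>
  congrArg Prod.fst ((frameMap Ψ).injective h)

theorem dist_le_dist_graphMap (p q : V) : dist p q ≤ dist (graphMap Ψ γ p) (graphMap Ψ γ q) := by
  simp only [graphMap, dist_eq_norm, ← map_sub]
  exact norm_fst_le_norm_frameMap Ψ ((p, γ p) - (q, γ q))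

theorem lipschitzWith_graphMap (hγ : LipschitzWith L γ) : LipschitzWith (1 + L) (graphMap Ψ γ) := by
  refine LipschitzWith.of_dist_le_mul fun p q => ?_
  have hsplit : graphMap Ψ γ p - graphMap Ψ γ q =
      frameMap Ψ (p - q, 0) + frameMap Ψ (0, γ p - γ q) := by simp [graphMap, ← map_sub, ← map_add]
  calc dist (graphMap Ψ γ p) (graphMap Ψ γ q)
      ≤ ‖frameMap Ψ (p - q, 0)‖ + ‖frameMap Ψ (0, γ p - γ q)‖ := by
        rw [dist_eq_norm, hsplit]; exact norm_add_le _ _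
    _ = dist p q + dist (γ p) (γ q) := by
        rw [norm_frameMap_horizontal, norm_frameMap_vertical, dist_eq_norm, Real.dist_eq]
    _ ≤ (1 + L : ℝ≥0) * dist p q := by
        push_cast; linarith [hγ.dist_le_mul p q]

theorem abs_dist_graphMap_sub_le {A : V →L[ℝ] ℝ} {s : Set V} {δ : ℝ≥0}
    (hA : ApproximatesLinearOn γ A s δ) {p q : V} (hp : p ∈ s) (hq : q ∈ s) :
    |dist (graphMap Ψ γ p) (graphMap Ψ γ q) - dist (graphMap Ψ A p) (graphMap Ψ A q)|
      ≤ δ * dist (graphMap Ψ A p) (graphMap Ψ A q) := by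
  have hdiff : graphMap Ψ γ p - graphMap Ψ γ q - (graphMap Ψ A p - graphMap Ψ A q)
      = frameMap Ψ (0, γ p - γ q - A (p - q)) := by simp [graphMap, ← map_sub]
  calc _ ≤ ‖frameMap Ψ (0, γ p - γ q - A (p - q))‖ := by
        rw [← hdiff, dist_eq_norm, dist_eq_norm]; exact abs_norm_sub_norm_le _ _
    _ = ‖γ p - γ q - A (p - q)‖ := norm_frameMap_vertical Ψ _
    _ ≤ δ * dist p q := by rw [dist_eq_norm]; exact hA p hp q hq
    _ ≤ _ := by gcongr; exact dist_le_dist_graphMap p q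

end GraphMap

section HausdorffMeasure

theorem euclideanHausdorffMeasure_image_le {α X Y : Type*} [MetricSpace X] [MeasurableSpace X]
    [BorelSpace X] [MetricSpace Y] [MeasurableSpace Y] [BorelSpace Y] {f : α → Y} {g : α → X}
    {s : Set α} {K : ℝ≥0} (n : ℕ)
    (h : ∀ p ∈ s, ∀ q ∈ s, dist (f p) (f q) ≤ K * dist (g p) (g q)) :
    μHE[n] (f '' s) ≤ (K : ℝ≥0∞) ^ n * μHE[n] (g '' s) := by
  rcases s.eq_empty_or_nonempty with rfl | ⟨p₀, -⟩
  · simp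
  have : Nonempty α := ⟨p₀⟩
  let k : X → Y := fun y => f (Function.invFunOn g s y)
  have hk : ∀ p ∈ s, k (g p) = f p := fun p hp => by
    have hmem : Function.invFunOn g s (g p) ∈ s := Function.invFunOn_mem ⟨p, hp, rfl⟩
    have heq : g (Function.invFunOn g s (g p)) = g p := Function.invFunOn_eq ⟨p, hp, rfl⟩
    simpa [heq] using h _ hmem p hp
  have himage : f '' s = k '' (g '' s) := by
    rw [image_image]; exact (image_congr hk).symm
  have hLip : LipschitzOnWith K k (g '' s) := by
    refine LipschitzOnWith.of_dist_le_mul ?_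
    rintro _ ⟨p, hp, rfl⟩ _ ⟨q, hq, rfl⟩
    rw [hk p hp, hk q hq]; exact h p hp q hq
  have hμ := hLip.hausdorffMeasure_image_le (d := (n : ℝ)) n.cast_nonneg
  rw [ENNReal.rpow_natCast] at hμ
  simp only [himage, Measure.euclideanHausdorffMeasure_def, Measure.smul_apply, ENNReal.smul_def,
    smul_eq_mul]
  rw [mul_left_comm]
  gcongr

end HausdorffMeasure

section GraphArea

variable {V E : Type*} [NormedAddCommGroup V] [InnerProductSpace ℝ V] [FiniteDimensional ℝ V]
  [MeasurableSpace V] [BorelSpace V]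
  [NormedAddCommGroup E] [InnerProductSpace ℝ E] [MeasurableSpace E] [BorelSpace E]
  {Ψ : WithLp 2 (V × ℝ) ≃ₗᵢ[ℝ] E} {γ : V → ℝ} {L : ℝ≥0}

theorem measurableEmbedding_graphMap (hγ : Continuous γ) : MeasurableEmbedding (graphMap Ψ γ) :=
  (continuous_graphMap hγ).measurableEmbedding injective_graphMap

theorem euclideanHausdorffMeasure_graphMap_linear (A : V →L[ℝ] ℝ) (s : Set V) :
    μHE[Module.finrank ℝ V] (graphMap Ψ A '' s) =
      ENNReal.ofReal (graphDensity A) * volume s := by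
  let T : V →ₗ[ℝ] E := (frameMap Ψ).toLinearEquiv.toLinearMap ∘ₗ LinearMap.id.prod A.toLinearMap
  have hT : T.normDet = graphDensity A :=
    normDet_eq_graphDensity fun p q => inner_frameMap Ψ (p, A p) (q, A q)
  rw [← hT]
  exact T.euclideanHausdorffMeasure_image_eq_normDet_mul_volume s

theorem euclideanHausdorffMeasure_graphMap_le (hγ : LipschitzWith L γ) (s : Set V) :
    μHE[Module.finrank ℝ V] (graphMap Ψ γ '' s) ≤
      ((1 + L : ℝ≥0) : ℝ≥0∞) ^ Module.finrank ℝ V * volume s := by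
  have hflat : μHE[Module.finrank ℝ V] (graphMap Ψ (0 : V →L[ℝ] ℝ) '' s) = volume s := by
    rw [euclideanHausdorffMeasure_graphMap_linear]; simp [graphDensity]
  rw [← hflat]
  refine euclideanHausdorffMeasure_image_le _ fun p _ q _ => ?_
  calc _ ≤ (1 + L : ℝ≥0) * dist p q := (lipschitzWith_graphMap hγ).dist_le_mul p q
    _ ≤ _ := by gcongr; exact dist_le_dist_graphMap p q

theorem ae_norm_fderiv_sub_le {A : V →L[ℝ] ℝ} {s : Set V} {δ : ℝ≥0} (hs : MeasurableSet s)
    (hA : ApproximatesLinearOn γ A s δ) (hd : ∀ p ∈ s, DifferentiableAt ℝ γ p) :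
    ∀ᵐ p ∂volume.restrict s, ‖fderiv ℝ γ p - A‖ ≤ δ := by
  cases subsingleton_or_nontrivial V
  · exact ae_of_all _ fun p => by simp [Subsingleton.elim (fderiv ℝ γ p) A]
  -- The library states this for maps `V → V`; compose with a unit vector of `V`.
  obtain ⟨w, hw⟩ := exists_norm_eq V zero_le_one
  have hnorm (T : V →L[ℝ] ℝ) : ‖T.smulRight w‖ = ‖T‖ := by
    rw [ContinuousLinearMap.norm_smulRight_apply, hw, mul_one]
  have hsub (T : V →L[ℝ] ℝ) : T.smulRight w - A.smulRight w = (T - A).smulRight w := by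
    ext; simp [sub_smul]
  have hAw : ApproximatesLinearOn (fun p => γ p • w) (A.smulRight w) s δ := fun p hp q hq => by
    have h := hA p hp q hq
    rwa [ContinuousLinearMap.smulRight_apply, ← sub_smul, ← sub_smul, norm_smul, hw, mul_one]
  filter_upwards [hAw.norm_fderiv_sub_le volume hs (fun p => (fderiv ℝ γ p).smulRight w)
    fun p hp => ((hd p hp).hasFDerivAt.smul_const w).hasFDerivWithinAt] with p hp
  rw [hsub, ← NNReal.coe_le_coe, coe_nnnorm, hnorm] at hp
  exact hp

/-- The area of the graph of `γ`, as a measure on the base space. -/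
def graphArea (Ψ : WithLp 2 (V × ℝ) ≃ₗᵢ[ℝ] E) (γ : V → ℝ) : Measure V :=
  (μHE[Module.finrank ℝ V]).comap (graphMap Ψ γ)

theorem graphArea_apply (hγ : Continuous γ) (s : Set V) :
    graphArea Ψ γ s = μHE[Module.finrank ℝ V] (graphMap Ψ γ '' s) :=
  (measurableEmbedding_graphMap hγ).comap_apply _ s

theorem graphArea_absolutelyContinuous (hγ : LipschitzWith L γ) : graphArea Ψ γ ≪ volume :=
  fun s hs => by
    rw [graphArea_apply hγ.continuous]
    exact nonpos_iff_eq_zero.1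
      ((euclideanHausdorffMeasure_graphMap_le hγ s).trans (by rw [hs, mul_zero]))

/-- The measure on the base space with density the surface element of the graph of `γ`. -/
def graphDensityMeasure (γ : V → ℝ) : Measure V :=
  volume.withDensity fun p => ENNReal.ofReal (graphDensity (fderiv ℝ γ p))

section ApproximatesLinearOn

variable {A : V →L[ℝ] ℝ} {s : Set V} {δ : ℝ≥0}

theorem graphArea_le_of_approximatesLinearOn (hγ : Continuous γ) (hs : MeasurableSet s)
    (hd : ∀ p ∈ s, DifferentiableAt ℝ γ p) (hA : ApproximatesLinearOn γ A s δ) :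
    graphArea Ψ γ s ≤
      ENNReal.ofReal ((1 + δ) ^ (Module.finrank ℝ V + 1)) * graphDensityMeasure γ s := by
  have hδ : (0 : ℝ) ≤ 1 + δ := by positivity
  calc graphArea Ψ γ s
      ≤ ((1 + δ : ℝ≥0) : ℝ≥0∞) ^ Module.finrank ℝ V *
          μHE[Module.finrank ℝ V] (graphMap Ψ A '' s) := by
        rw [graphArea_apply hγ]
        refine euclideanHausdorffMeasure_image_le _ fun p hp q hq => ?_
        push_cast
        linarith [(abs_le.1 (abs_dist_graphMap_sub_le (Ψ := Ψ) hA hp hq)).2]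
    _ = ENNReal.ofReal ((1 + δ) ^ Module.finrank ℝ V) *
          ∫⁻ _ in s, ENNReal.ofReal (graphDensity A) := by
        rw [euclideanHausdorffMeasure_graphMap_linear, setLIntegral_const, ENNReal.ofReal_pow hδ,
          ← ENNReal.ofReal_coe_nnreal, NNReal.coe_add, NNReal.coe_one]
    _ ≤ ENNReal.ofReal ((1 + δ) ^ Module.finrank ℝ V) *
          ∫⁻ p in s, ENNReal.ofReal (1 + δ) * ENNReal.ofReal (graphDensity (fderiv ℝ γ p)) := by
        gcongr ENNReal.ofReal ((1 + δ) ^ Module.finrank ℝ V) * ?_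
        refine lintegral_mono_ae ?_
        filter_upwards [ae_norm_fderiv_sub_le hs hA hd] with _ hp
        rw [← ENNReal.ofReal_mul hδ]
        exact ENNReal.ofReal_le_ofReal (graphDensity_le_mul (by rwa [norm_sub_rev]))
    _ = _ := by
        rw [graphDensityMeasure, withDensity_apply _ hs,
          lintegral_const_mul _ (measurable_graphDensity_fderiv γ), ← mul_assoc,
          ← ENNReal.ofReal_mul (by positivity), pow_succ]

theorem graphDensityMeasure_le_of_approximatesLinearOn (hγ : Continuous γ) (hs : MeasurableSet s)
    (hd : ∀ p ∈ s, DifferentiableAt ℝ γ p) (hA : ApproximatesLinearOn γ A s δ) (hδ : δ < 1) :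
    graphDensityMeasure γ s ≤
      ENNReal.ofReal ((1 + δ) * (1 - (δ : ℝ))⁻¹ ^ Module.finrank ℝ V) * graphArea Ψ γ s := by
  have hδ' : 0 < 1 - (δ : ℝ) := sub_pos.2 (by exact_mod_cast hδ)
  calc graphDensityMeasure γ s
      ≤ ∫⁻ _ in s, ENNReal.ofReal (1 + δ) * ENNReal.ofReal (graphDensity A) := by
        rw [graphDensityMeasure, withDensity_apply _ hs]
        refine lintegral_mono_ae ?_
        filter_upwards [ae_norm_fderiv_sub_le hs hA hd] with _ hp
        rw [← ENNReal.ofReal_mul (by positivity)]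
        exact ENNReal.ofReal_le_ofReal (graphDensity_le_mul hp)
    _ = ENNReal.ofReal (1 + δ) * μHE[Module.finrank ℝ V] (graphMap Ψ A '' s) := by
        rw [euclideanHausdorffMeasure_graphMap_linear, setLIntegral_const, mul_assoc]
    _ ≤ ENNReal.ofReal (1 + δ) *
          (((1 - δ)⁻¹ : ℝ≥0) ^ Module.finrank ℝ V * graphArea Ψ γ s) := by
        rw [graphArea_apply hγ]
        gcongr
        refine euclideanHausdorffMeasure_image_le _ fun p hp q hq => ?_
        rw [NNReal.coe_inv, NNReal.coe_sub hδ.le, NNReal.coe_one, ← div_eq_inv_mul, le_div_iff₀ hδ']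
        linarith [(abs_le.1 (abs_dist_graphMap_sub_le (Ψ := Ψ) hA hp hq)).1]
    _ = _ := by
        rw [← mul_assoc, ENNReal.ofReal_mul (by positivity), ENNReal.ofReal_pow (by positivity),
          ← ENNReal.ofReal_coe_nnreal, NNReal.coe_inv, NNReal.coe_sub hδ.le, NNReal.coe_one]

end ApproximatesLinearOn

theorem measure_le_of_approximatesLinearOn {μ ν : Measure V} {c : ℝ≥0∞} {δ : ℝ≥0} (hδ : δ ≠ 0)
    {s : Set V} (hs : MeasurableSet s) (hd : ∀ p ∈ s, DifferentiableAt ℝ γ p)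
    (h : ∀ (t : Set V) (A : V →L[ℝ] ℝ), MeasurableSet t → t ⊆ s →
      ApproximatesLinearOn γ A t δ → μ t ≤ c * ν t) :
    μ s ≤ c * ν s := by
  obtain ⟨t, A, hdisj, ht, hcover, hA, -⟩ :=
    exists_partition_approximatesLinearOn_of_hasFDerivWithinAt γ s (fderiv ℝ γ)
      (fun p hp => (hd p hp).hasFDerivAt.hasFDerivWithinAt) (fun _ => δ) (fun _ => hδ)
  have hunion : s = ⋃ n, s ∩ t n := by rw [← inter_iUnion, inter_eq_left.2 hcover]
  have hpieces (ρ : Measure V) : ρ s = ∑' n, ρ (s ∩ t n) := by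
    conv_lhs => rw [hunion]
    exact measure_iUnion (fun i j hij => (hdisj hij).mono inter_subset_right inter_subset_right)
      fun n => hs.inter (ht n)
  rw [hpieces μ, hpieces ν, ← ENNReal.tsum_mul_left]
  exact ENNReal.tsum_le_tsum fun n => h _ (A n) (hs.inter (ht n)) inter_subset_left (hA n)

theorem ennreal_le_of_forall_le_mul {x y : ℝ≥0∞} {c : ℝ → ℝ} (hc : ContinuousAt c 0)
    (hc0 : c 0 = 1) (h : ∀ δ : ℝ≥0, δ ≠ 0 → δ < 1 → x ≤ ENNReal.ofReal (c δ) * y) : x ≤ y := by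
  have hlim : Tendsto (fun δ => ENNReal.ofReal (c δ) * y) (𝓝[>] 0) (𝓝 (1 * y)) := by
    refine ENNReal.Tendsto.mul_const ?_ (Or.inl one_ne_zero)
    simpa [hc0] using (ENNReal.tendsto_ofReal hc.tendsto).mono_left
      (nhdsWithin_le_nhds (s := Ioi 0))
  rw [one_mul] at hlim
  refine ge_of_tendsto hlim ?_
  filter_upwards [Ioo_mem_nhdsGT one_pos] with δ hδ
  exact h ⟨δ, hδ.1.le⟩ (fun h₀ => hδ.1.ne' (congrArg NNReal.toReal h₀)) hδ.2

theorem graphArea_eq_of_differentiable (hγ : Continuous γ) {s : Set V} (hs : MeasurableSet s)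
    (hd : ∀ p ∈ s, DifferentiableAt ℝ γ p) : graphArea Ψ γ s = graphDensityMeasure γ s := by
  refine le_antisymm
    (ennreal_le_of_forall_le_mul (c := fun δ => (1 + δ) ^ (Module.finrank ℝ V + 1))
      (by fun_prop) (by simp) fun δ hδ _ =>
        measure_le_of_approximatesLinearOn hδ hs hd fun t A ht hts hA =>
          graphArea_le_of_approximatesLinearOn hγ ht (fun p hp => hd p (hts hp)) hA)
    (ennreal_le_of_forall_le_mul (c := fun δ => (1 + δ) * (1 - δ)⁻¹ ^ Module.finrank ℝ V)
      (by fun_prop (disch := simp)) (by simp) fun δ hδ hδ' =>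
        measure_le_of_approximatesLinearOn hδ hs hd fun t A ht hts hA =>
          graphDensityMeasure_le_of_approximatesLinearOn hγ ht (fun p hp => hd p (hts hp)) hA hδ')

theorem graphArea_eq_graphDensityMeasure (hγ : LipschitzWith L γ) :
    graphArea Ψ γ = graphDensityMeasure γ := by
  have hdiff : {p | DifferentiableAt ℝ γ p} ∈ ae volume := hγ.ae_differentiableAt
  have hdiff_area := graphArea_absolutelyContinuous (Ψ := Ψ) hγ hdiff
  have hdiff_density := withDensity_absolutelyContinuous volume
    (fun p => ENNReal.ofReal (graphDensity (fderiv ℝ γ p))) hdiff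
  ext s hs
  rw [← measure_inter_conull hdiff_area, graphArea_eq_of_differentiable hγ.continuous
    (hs.inter (measurableSet_of_differentiableAt ℝ γ)) fun p hp => hp.2, graphDensityMeasure,
    measure_inter_conull hdiff_density]

theorem restrict_range_graphMap (hγ : LipschitzWith L γ) :
    (μHE[Module.finrank ℝ V] : Measure E).restrict (range (graphMap Ψ γ)) =
      (graphDensityMeasure γ).map (graphMap Ψ γ) := by
  rw [← graphArea_eq_graphDensityMeasure (Ψ := Ψ) hγ, graphArea,
    (measurableEmbedding_graphMap hγ.continuous).map_comap]

end GraphArea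

theorem integrable_fderiv_apply {E F : Type*} [NormedAddCommGroup E] [NormedSpace ℝ E]
    [MeasurableSpace E] [OpensMeasurableSpace E] [NormedAddCommGroup F] [NormedSpace ℝ F]
    {μ : Measure E} [IsFiniteMeasureOnCompacts μ] {f : E → F} (hf : ContDiff ℝ 1 f)
    (hc : HasCompactSupport f) (v : E) : Integrable (fun y => fderiv ℝ f y v) μ :=
  ((hf.continuous_fderiv one_ne_zero).clm_apply continuous_const).integrable_of_hasCompactSupport
    (hc.fderiv_apply (𝕜 := ℝ) v)

section Subgraph

section Shear

variable {V : Type*} [NormedAddCommGroup V] {γ : V → ℝ}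

/-- The vertical shear by `γ`, which straightens the subgraph of `γ` to the lower half-space. -/
def shearHomeomorph (hγ : Continuous γ) : (V × ℝ) ≃ₜ (V × ℝ) where
  toFun a := (a.1, γ a.1 + a.2)
  invFun a := (a.1, -γ a.1 + a.2)
  left_inv a := by simp
  right_inv a := by simp

theorem shearHomeomorph_preimage_subgraph (hγ : Continuous γ) :
    shearHomeomorph hγ ⁻¹' {a | a.2 < γ a.1} = univ ×ˢ Iio 0 := by
  ext a
  simp [shearHomeomorph]

theorem fderiv_eq_tangential_add_vertical [NormedSpace ℝ V] (f : V × ℝ → ℝ) (A : V →L[ℝ] ℝ)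
    (a v : V × ℝ) :
    fderiv ℝ f a v = fderiv ℝ f a (v.1, A v.1) + fderiv ℝ f a (0, 1) * (v.2 - A v.1) := by
  have hv : v = (v.1, A v.1) + (v.2 - A v.1) • ((0 : V), (1 : ℝ)) := by ext <;> simp
  conv_lhs => rw [hv, map_add, map_smul, smul_eq_mul, mul_comm]

theorem integral_Iio_fderiv_vertical [NormedSpace ℝ V] {f : V × ℝ → ℝ} (hf : ContDiff ℝ 1 f)
    (hc : HasCompactSupport f) (a : V × ℝ) :
    ∫ t in Iio (0 : ℝ), fderiv ℝ f (a.1, a.2 + t) (0, 1) = f a := by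
  let g : ℝ → ℝ := fun t => f (a.1, a.2 + t)
  have hg : ContDiff ℝ 1 g := hf.comp (by fun_prop)
  have hgc : HasCompactSupport g := by
    refine HasCompactSupport.intro ((hc.image continuous_snd).image
      (f := fun t => t - a.2) (by fun_prop)) fun t ht => ?_
    by_contra hne
    exact ht ⟨_, ⟨_, subset_tsupport _ hne, rfl⟩, by simp⟩
  have hderiv (t : ℝ) : deriv g t = fderiv ℝ f (a.1, a.2 + t) (0, 1) := by
    have hline : HasDerivAt (fun t : ℝ => (a.1, a.2 + t)) ((0 : V), (1 : ℝ)) t :=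
      (hasDerivAt_const t a.1).prodMk ((hasDerivAt_id t).const_add _)
    exact ((hf.differentiable one_ne_zero _).hasFDerivAt.comp_hasDerivAt t hline).deriv
  have hFTC := hgc.integral_Iic_deriv_eq hg 0
  simp only [hderiv, integral_Iic_eq_integral_Iio] at hFTC
  simpa [g] using hFTC

end Shear

variable {V : Type*} [NormedAddCommGroup V] [InnerProductSpace ℝ V] [FiniteDimensional ℝ V]
  [MeasurableSpace V] [BorelSpace V] {γ : V → ℝ} {L : ℝ≥0}

theorem measurePreserving_shearHomeomorph (hγ : Continuous γ) :
    MeasurePreserving (shearHomeomorph hγ) (volume : Measure (V × ℝ)) volume :=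
  (MeasurePreserving.id (volume : Measure V)).skew_product (g := fun p t => γ p + t)
    (by unfold Function.uncurry; fun_prop) (ae_of_all _ fun p => map_add_left_eq_self volume (γ p))

theorem setIntegral_subgraph (hγ : Continuous γ) (g : V × ℝ → ℝ) :
    ∫ a in {a : V × ℝ | a.2 < γ a.1}, g a = ∫ a in univ ×ˢ Iio 0, g (shearHomeomorph hγ a) := by
  rw [← shearHomeomorph_preimage_subgraph hγ]
  exact ((measurePreserving_shearHomeomorph hγ).setIntegral_preimage_emb
    (shearHomeomorph hγ).measurableEmbedding g _).symm

theorem integral_lineDeriv_eq_zero {φ : V → ℝ} {C : ℝ≥0} (hφ : LipschitzWith C φ)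
    (hc : HasCompactSupport φ) (v : V) : ∫ p, lineDeriv ℝ φ p v = 0 := by
  have h := LipschitzWith.integral_lineDeriv_mul_eq (μ := volume)
    (LipschitzWith.const (α := V) (1 : ℝ)) hφ hc (-v)
  simpa [lineDeriv] using h.symm

theorem integral_fderiv_tangential_eq_zero (hγ : LipschitzWith L γ) {f : V × ℝ → ℝ}
    (hf : ContDiff ℝ 1 f) (hc : HasCompactSupport f) (v : V) (t : ℝ) :
    ∫ p, fderiv ℝ f (p, γ p + t) (v, fderiv ℝ γ p v) = 0 := by
  obtain ⟨C, hC⟩ := hf.lipschitzWith_of_hasCompactSupport hc one_ne_zero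
  let φ : V → ℝ := fun p => f (p, γ p + t)
  have hφ : LipschitzWith (C * max 1 L) φ :=
    hC.comp (LipschitzWith.id.prodMk (LipschitzWith.of_dist_le_mul fun p q => by
      simpa [dist_add_right] using hγ.dist_le_mul p q))
  have hφc : HasCompactSupport φ := by
    refine HasCompactSupport.intro (hc.image continuous_fst) fun p hp => ?_
    by_contra hne
    exact hp ⟨_, subset_tsupport _ hne, rfl⟩
  rw [← integral_lineDeriv_eq_zero hφ hφc v]
  refine integral_congr_ae ?_
  filter_upwards [hγ.ae_differentiableAt (μ := volume)] with p hp
  have hgraph : HasFDerivAt (fun p => (p, γ p + t))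
      ((ContinuousLinearMap.id ℝ V).prod (fderiv ℝ γ p)) p :=
    (hasFDerivAt_id p).prodMk (hp.hasFDerivAt.add_const t)
  exact (((hf.differentiable one_ne_zero _).hasFDerivAt.comp p hgraph).hasLineDerivAt
    v).lineDeriv.symm

theorem integrable_mul_sub_fderiv (hγ : LipschitzWith L γ) {g : V × ℝ → ℝ} (hg : Integrable g)
    (v : V × ℝ) : Integrable fun a => g a * (v.2 - fderiv ℝ γ a.1 v.1) := by
  refine hg.mul_bdd (c := |v.2| + L * ‖v.1‖)
    (measurable_const.sub ((measurable_fderiv_apply_const ℝ γ v.1).comp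
      measurable_fst)).aestronglyMeasurable (ae_of_all _ fun a => (norm_sub_le _ _).trans ?_)
  refine add_le_add le_rfl ((ContinuousLinearMap.le_opNorm _ _).trans ?_)
  gcongr
  exact norm_fderiv_le_of_lipschitz ℝ hγ

theorem integral_subgraph_fderiv (hγ : LipschitzWith L γ) {f : V × ℝ → ℝ} (hf : ContDiff ℝ 1 f)
    (hc : HasCompactSupport f) (v : V × ℝ) :
    ∫ a in {a : V × ℝ | a.2 < γ a.1}, fderiv ℝ f a v =
      ∫ p, f (p, γ p) * (v.2 - fderiv ℝ γ p v.1) := by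
  let S := shearHomeomorph hγ.continuous
  let F : V × ℝ → ((V × ℝ) →L[ℝ] ℝ) := fun a => fderiv ℝ f (S a)
  let slope : V → ℝ := fun p => fderiv ℝ γ p v.1
  let tangential : V × ℝ → ℝ := fun a => F a (v.1, slope a.1)
  let vertical : V × ℝ → ℝ := fun a => F a (0, 1) * (v.2 - slope a.1)
  have hF (w : V × ℝ) : Integrable fun a => F a w :=
    (measurePreserving_shearHomeomorph hγ.continuous).integrable_comp_of_integrable
      (integrable_fderiv_apply hf hc w)
  have hsplit (a : V × ℝ) : F a v = tangential a + vertical a :=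
    fderiv_eq_tangential_add_vertical f (fderiv ℝ γ a.1) (S a) v
  have hvert : Integrable vertical := integrable_mul_sub_fderiv hγ (hF _) v
  have htang : Integrable tangential :=
    ((hF v).sub hvert).congr (ae_of_all _ fun a => sub_eq_of_eq_add (hsplit a))
  calc ∫ a in {a : V × ℝ | a.2 < γ a.1}, fderiv ℝ f a v
      = ∫ a in univ ×ˢ Iio 0, F a v := setIntegral_subgraph hγ.continuous _
    _ = (∫ a in univ ×ˢ Iio 0, tangential a) + ∫ a in univ ×ˢ Iio 0, vertical a := by
        simp only [hsplit]
        exact integral_add htang.integrableOn hvert.integrableOn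
    _ = (∫ t in Iio 0, ∫ p, tangential (p, t)) + ∫ p, ∫ t in Iio 0, vertical (p, t) := by
        simp only [Measure.volume_eq_prod] at htang hvert ⊢
        rw [setIntegral_prod _ hvert.integrableOn, ← setIntegral_prod_swap,
          setIntegral_prod (fun a => tangential a.swap) htang.swap.integrableOn,
          Measure.restrict_univ]
        rfl
    _ = ∫ p, f (p, γ p) * (v.2 - fderiv ℝ γ p v.1) := by
        have hzero (t : ℝ) : ∫ p, tangential (p, t) = 0 :=
          integral_fderiv_tangential_eq_zero hγ hf hc v.1 t
        have hboundary (p : V) : ∫ t in Iio 0, vertical (p, t) = f (p, γ p) * (v.2 - slope p) := by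
          rw [← integral_Iio_fderiv_vertical hf hc (p, γ p)]
          exact integral_mul_const (v.2 - slope p) fun t => F (p, t) (0, 1)
        simp only [hzero, hboundary, integral_zero, zero_add, slope]

end Subgraph

section GraphNormal

variable {V E : Type*} [NormedAddCommGroup V] [InnerProductSpace ℝ V] [CompleteSpace V]
  [NormedAddCommGroup E] [InnerProductSpace ℝ E]

/-- The upward unit normal of a graph with slope `A`. -/
def graphNormal (Ψ : WithLp 2 (V × ℝ) ≃ₗᵢ[ℝ] E) (A : V →L[ℝ] ℝ) : E :=
  (graphDensity A)⁻¹ • frameMap Ψ (-(InnerProductSpace.toDual ℝ V).symm A, 1)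

variable (Ψ : WithLp 2 (V × ℝ) ≃ₗᵢ[ℝ] E)

theorem inner_frameMap_graphNormal (A : V →L[ℝ] ℝ) (w : V × ℝ) :
    ⟪frameMap Ψ w, graphNormal Ψ A⟫_ℝ = (graphDensity A)⁻¹ * (w.2 - A w.1) := by
  rw [graphNormal, real_inner_smul_right, inner_frameMap, inner_neg_right, real_inner_comm,
    InnerProductSpace.toDual_symm_apply]
  ring

theorem norm_graphNormal (A : V →L[ℝ] ℝ) : ‖graphNormal Ψ A‖ = 1 := by
  have hnorm : ‖frameMap Ψ (-(InnerProductSpace.toDual ℝ V).symm A, 1)‖ = graphDensity A := by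
    refine (sq_eq_sq₀ (norm_nonneg _) (graphDensity_pos A).le).1 ?_
    rw [norm_frameMap_sq, norm_neg, LinearIsometryEquiv.norm_map, graphDensity_sq]
    ring
  rw [graphNormal, norm_smul, hnorm, norm_inv, Real.norm_of_nonneg (graphDensity_pos A).le,
    inv_mul_cancel₀ (graphDensity_pos A).ne']

theorem continuous_graphNormal : Continuous (graphNormal Ψ) := by
  unfold graphNormal
  exact (continuous_graphDensity.inv₀ fun A => (graphDensity_pos A).ne').smul (by fun_prop)

end GraphNormal

section OuterNormal

theorem IsOuterUnitNormal.outerNormal_eq {B : Set E3} {z ν : E3} (h : IsOuterUnitNormal B z ν) :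
    outerNormal B z = ν := by
  have hex : ∃ ν, IsOuterUnitNormal B z ν := ⟨ν, h⟩
  rw [outerNormal, dif_pos hex]
  exact hex.choose_spec.unique h

theorem norm_outerNormal_le (B : Set E3) (z : E3) : ‖outerNormal B z‖ ≤ 1 := by
  by_cases hex : ∃ ν, IsOuterUnitNormal B z ν
  · rw [outerNormal, dif_pos hex]
    exact hex.choose_spec.1.le
  · rw [outerNormal, dif_neg hex, norm_zero]
    exact zero_le_one

end OuterNormal

section Patch

/-- The plane over which the pieces of a boundary in `ℝ³` are graphs. -/
abbrev E2 : Type := EuclideanSpace ℝ (Fin 2)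

/-- In the open set `U`, the set `B` is the strict subgraph of the Lipschitz function `γ` in the
orthonormal coordinates `Ψ`. -/
structure IsPatch (B U : Set E3) (Ψ : WithLp 2 (E2 × ℝ) ≃ₗᵢ[ℝ] E3) (γ : E2 → ℝ) (L : ℝ≥0) :
    Prop where
  lipschitz : LipschitzWith L γ
  isOpen : IsOpen U
  isBounded : Bornology.IsBounded U
  mem_iff : ∀ a, frameMap Ψ a ∈ U → (frameMap Ψ a ∈ B ↔ a.2 < γ a.1)

theorem IsLipschitzDomain.exists_isPatch {B : Set E3} (hB : IsLipschitzDomain B) {z : E3}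
    (hz : z ∈ frontier B) : ∃ U Ψ γ L, z ∈ U ∧ IsPatch B U Ψ γ L := by
  obtain ⟨e, g, L, r, he, hg, hr, hgr⟩ := hB.exists_graph z hz
  obtain ⟨Ψ, rfl⟩ := exists_frame (V := E2) (by simp) he
  refine ⟨Metric.ball z r, Ψ, fun p => g (frameMap Ψ (p, 0)), L, Metric.mem_ball_self hr, ?_,
    Metric.isOpen_ball, Metric.isBounded_ball, fun a ha => ?_⟩
  · refine LipschitzWith.of_dist_le_mul fun p q => (hg.dist_le_mul _ _).trans_eq ?_
    rw [dist_eq_norm, ← map_sub, Prod.mk_sub_mk, sub_zero, norm_frameMap_horizontal, dist_eq_norm]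
  · rw [hgr _ ha, inner_vertical_frameMap, sub_eq_of_eq_add (frameMap_eq_horizontal_add Ψ a)]

namespace IsPatch

variable {B U : Set E3} {Ψ : WithLp 2 (E2 × ℝ) ≃ₗᵢ[ℝ] E3} {γ : E2 → ℝ} {L : ℝ≥0}

theorem notMem_closure (h : IsPatch B U Ψ γ L) {a : E2 × ℝ} (ha : frameMap Ψ a ∈ U)
    (hlt : γ a.1 < a.2) : frameMap Ψ a ∉ closure B := by
  have habove : ∀ᶠ b in 𝓝 a, γ b.1 < b.2 :=
    (h.lipschitz.continuous.comp continuous_fst).continuousAt.eventually_lt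
      continuous_snd.continuousAt hlt
  have hU : ∀ᶠ b in 𝓝 a, frameMap Ψ b ∈ U :=
    (frameMap Ψ).continuous.continuousAt (h.isOpen.mem_nhds ha)
  have hsymm : Tendsto (frameMap Ψ).symm (𝓝 (frameMap Ψ a)) (𝓝 a) := by
    simpa using (frameMap Ψ).symm.continuous.tendsto (frameMap Ψ a)
  refine fun hcl => mem_closure_iff_frequently.1 hcl ?_
  filter_upwards [hsymm.eventually (habove.and hU)] with y ⟨hy, hyU⟩ hyB
  have hbelow := (h.mem_iff ((frameMap Ψ).symm y) hyU).1 (by rwa [(frameMap Ψ).apply_symm_apply])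
  exact hy.not_gt hbelow

theorem mem_closure (h : IsPatch B U Ψ γ L) {a : E2 × ℝ} (ha : frameMap Ψ a ∈ U)
    (heq : a.2 = γ a.1) : frameMap Ψ a ∈ closure B := by
  have hcont : Continuous fun t : ℝ => frameMap Ψ (a.1, a.2 - t) := by fun_prop
  have hlim : Tendsto (fun t : ℝ => frameMap Ψ (a.1, a.2 - t)) (𝓝[>] 0) (𝓝 (frameMap Ψ a)) := by
    simpa using (hcont.tendsto 0).mono_left nhdsWithin_le_nhds
  refine mem_closure_of_tendsto hlim ?_
  filter_upwards [hlim.eventually (h.isOpen.mem_nhds ha), self_mem_nhdsWithin] with t htU ht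
  rw [h.mem_iff _ htU, ← heq]
  exact sub_lt_self _ ht

theorem mem_frontier_iff (h : IsPatch B U Ψ γ L) (hB : IsOpen B) {a : E2 × ℝ}
    (ha : frameMap Ψ a ∈ U) : frameMap Ψ a ∈ frontier B ↔ a.2 = γ a.1 := by
  rw [hB.frontier_eq, Set.mem_sdiff, h.mem_iff a ha, not_lt]
  refine ⟨fun ⟨hcl, hle⟩ => ?_, fun heq => ⟨h.mem_closure ha heq, heq.ge⟩⟩
  exact (not_lt.1 fun hlt => h.notMem_closure ha hlt hcl).antisymm hle

theorem frontier_inter (h : IsPatch B U Ψ γ L) (hB : IsOpen B) :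
    frontier B ∩ U = range (graphMap Ψ γ) ∩ U := by
  ext y
  obtain ⟨a, rfl⟩ := (frameMap Ψ).surjective y
  refine and_congr_left fun ha => (h.mem_frontier_iff hB ha).trans
    ⟨fun heq => ⟨a.1, by rw [graphMap, ← heq]⟩, ?_⟩
  rintro ⟨p, hp⟩
  rw [← (frameMap Ψ).injective hp]

theorem restrict_surfaceMeasure (h : IsPatch B U Ψ γ L) (hB : IsOpen B) :
    (surfaceMeasure B).restrict U =
      ((graphDensityMeasure γ).map (graphMap Ψ γ)).restrict U := by
  have hgraph := restrict_range_graphMap (Ψ := Ψ) h.lipschitz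
  rw [finrank_euclideanSpace_fin] at hgraph
  rw [surfaceMeasure, Measure.restrict_restrict h.isOpen.measurableSet, inter_comm,
    h.frontier_inter hB, ← hgraph, Measure.restrict_restrict h.isOpen.measurableSet, inter_comm]

theorem surfaceMeasure_lt_top (h : IsPatch B U Ψ γ L) (hB : IsOpen B) :
    surfaceMeasure B U < ∞ := by
  have hbase : Bornology.IsBounded (graphMap Ψ γ ⁻¹' U) := by
    obtain ⟨R, hR⟩ := h.isBounded.exists_norm_le
    exact isBounded_iff_forall_norm_le.2
      ⟨R, fun p hp => (norm_fst_le_norm_frameMap Ψ (p, γ p)).trans (hR _ hp)⟩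
  have harea := euclideanHausdorffMeasure_graphMap_le (Ψ := Ψ) h.lipschitz (graphMap Ψ γ ⁻¹' U)
  rw [finrank_euclideanSpace_fin] at harea
  rw [surfaceMeasure, Measure.restrict_apply h.isOpen.measurableSet, inter_comm,
    h.frontier_inter hB, inter_comm, ← image_preimage_eq_inter_range]
  exact harea.trans_lt (ENNReal.mul_lt_top (by simp) hbase.measure_lt_top)

theorem isOuterUnitNormal (h : IsPatch B U Ψ γ L) {p : E2} (hp : graphMap Ψ γ p ∈ U)
    (hd : DifferentiableAt ℝ γ p) :
    IsOuterUnitNormal B (graphMap Ψ γ p) (graphNormal Ψ (fderiv ℝ γ p)) := by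
  refine ⟨norm_graphNormal Ψ _, fun ε hε => ?_⟩
  set A := fderiv ℝ γ p
  have hfst : Tendsto (fun y => ((frameMap Ψ).symm y).1) (𝓝 (graphMap Ψ γ p)) (𝓝 p) := by
    have hcont : Continuous fun y => ((frameMap Ψ).symm y).1 := by fun_prop
    simpa [graphMap] using hcont.tendsto (graphMap Ψ γ p)
  obtain ⟨δ, hδ, hball⟩ := Metric.eventually_nhds_iff_ball.1
    ((hfst.eventually ((hasFDerivAt_iff_isLittleO.1 hd.hasFDerivAt).bound hε)).and
      (h.isOpen.mem_nhds hp))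
  refine ⟨δ, hδ, fun y hy => ?_⟩
  obtain ⟨hlin, hyU⟩ := hball y hy
  obtain ⟨a, rfl⟩ := (frameMap Ψ).surjective y
  simp only [(frameMap Ψ).symm_apply_apply] at hlin
  have hsub : frameMap Ψ a - graphMap Ψ γ p = frameMap Ψ (a - (p, γ p)) := by
    rw [graphMap, map_sub]
  set height := ⟪frameMap Ψ a - graphMap Ψ γ p, graphNormal Ψ A⟫_ℝ with hheight
  set r := ‖frameMap Ψ a - graphMap Ψ γ p‖
  have hgap : |γ a.1 - γ p - A (a.1 - p)| ≤ ε * r := by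
    have hfst_le := norm_fst_le_norm_frameMap Ψ (a - (p, γ p))
    rw [← hsub] at hfst_le
    exact hlin.trans (mul_le_mul_of_nonneg_left hfst_le hε.le)
  have hheight_mul : graphDensity A * height = a.2 - γ p - A (a.1 - p) := by
    rw [hheight, hsub, inner_frameMap_graphNormal, mul_inv_cancel_left₀ (graphDensity_pos A).ne']
    rfl
  have hscale : ε * r ≤ graphDensity A * (ε * r) :=
    le_mul_of_one_le_left (by positivity) (one_le_graphDensity A)
  have hgap' := abs_le.1 hgap
  rw [h.mem_iff a hyU]
  refine ⟨fun hbelow => ?_, fun habove => not_lt.2 ?_⟩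
  · nlinarith [mul_lt_mul_of_pos_left hbelow (graphDensity_pos A)]
  · nlinarith [mul_lt_mul_of_pos_left habove (graphDensity_pos A)]

theorem ae_restrict_of_ae (h : IsPatch B U Ψ γ L) (hB : IsOpen B) {Q : E3 → Prop}
    (hQ : ∀ᵐ p : E2, graphMap Ψ γ p ∈ U → Q (graphMap Ψ γ p)) :
    ∀ᵐ y ∂(surfaceMeasure B).restrict U, Q y := by
  rw [h.restrict_surfaceMeasure hB, ae_restrict_iff' h.isOpen.measurableSet,
    (measurableEmbedding_graphMap h.lipschitz.continuous).ae_map_iff]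
  exact withDensity_absolutelyContinuous _ _ hQ

theorem ae_outerNormal_eq (h : IsPatch B U Ψ γ L) (hB : IsOpen B) :
    ∀ᵐ y ∂(surfaceMeasure B).restrict U,
      outerNormal B y = graphNormal Ψ (fderiv ℝ γ ((frameMap Ψ).symm y).1) := by
  refine h.ae_restrict_of_ae hB ?_
  filter_upwards [h.lipschitz.ae_differentiableAt (μ := volume)] with p hp hU
  rw [(h.isOuterUnitNormal hU hp).outerNormal_eq, graphMap, (frameMap Ψ).symm_apply_apply]

theorem aestronglyMeasurable_outerNormal (h : IsPatch B U Ψ γ L) (hB : IsOpen B) :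
    AEStronglyMeasurable (outerNormal B) ((surfaceMeasure B).restrict U) := by
  have hfst : Continuous fun y => ((frameMap Ψ).symm y).1 := by fun_prop
  have hmeas : Measurable fun y => graphNormal Ψ (fderiv ℝ γ ((frameMap Ψ).symm y).1) :=
    (continuous_graphNormal Ψ).measurable.comp ((measurable_fderiv ℝ γ).comp hfst.measurable)
  exact hmeas.aestronglyMeasurable.congr ((h.ae_outerNormal_eq hB).mono fun _ hy => hy.symm)

theorem setIntegral_eq_subgraph (h : IsPatch B U Ψ γ L) (hB : IsOpen B) {g : E3 → ℝ}
    (hg : ∀ y, y ∉ U → g y = 0) :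
    ∫ y in B, g y = ∫ a in {a : E2 × ℝ | a.2 < γ a.1}, g (frameMap Ψ a) := by
  have hsub : MeasurableSet {a : E2 × ℝ | a.2 < γ a.1} :=
    measurableSet_lt measurable_snd (h.lipschitz.continuous.measurable.comp measurable_fst)
  rw [← (measurePreserving_frameMap Ψ).setIntegral_preimage_emb
    (frameMap Ψ).toHomeomorph.measurableEmbedding,
    ← integral_indicator ((frameMap Ψ).continuous.measurable hB.measurableSet),
    ← integral_indicator hsub]
  congr 1 with a
  by_cases ha : frameMap Ψ a ∈ U
  · exact indicator_eq_indicator (h.mem_iff a ha) rfl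
  · simp [indicator, hg _ ha]

theorem integral_surfaceMeasure_eq (h : IsPatch B U Ψ γ L) (hB : IsOpen B) {f : E3 → ℝ}
    (hf : ∀ y, y ∉ U → f y = 0) (w : E2 × ℝ) :
    ∫ y, f y * ⟪frameMap Ψ w, outerNormal B y⟫_ℝ ∂surfaceMeasure B =
      ∫ p, f (graphMap Ψ γ p) * (w.2 - fderiv ℝ γ p w.1) := by
  let ν : E3 → E3 := fun y => graphNormal Ψ (fderiv ℝ γ ((frameMap Ψ).symm y).1)
  have hzero (n : E3 → E3) (y : E3) (hy : y ∉ U) : f y * ⟪frameMap Ψ w, n y⟫_ℝ = 0 := by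
    rw [hf y hy, zero_mul]
  calc ∫ y, f y * ⟪frameMap Ψ w, outerNormal B y⟫_ℝ ∂surfaceMeasure B
      = ∫ y in U, f y * ⟪frameMap Ψ w, outerNormal B y⟫_ℝ ∂surfaceMeasure B :=
        (setIntegral_eq_integral_of_forall_compl_eq_zero (hzero _)).symm
    _ = ∫ y in U, f y * ⟪frameMap Ψ w, ν y⟫_ℝ ∂surfaceMeasure B :=
        integral_congr_ae ((h.ae_outerNormal_eq hB).mono fun y hy => by simp only [hy, ν])
    _ = ∫ y, f y * ⟪frameMap Ψ w, ν y⟫_ℝ ∂(graphDensityMeasure γ).map (graphMap Ψ γ) := by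
        rw [h.restrict_surfaceMeasure hB, setIntegral_eq_integral_of_forall_compl_eq_zero (hzero ν)]
    _ = ∫ p, graphDensity (fderiv ℝ γ p) *
          (f (graphMap Ψ γ p) * ⟪frameMap Ψ w, graphNormal Ψ (fderiv ℝ γ p)⟫_ℝ) := by
        rw [(measurableEmbedding_graphMap h.lipschitz.continuous).integral_map,
          graphDensityMeasure, integral_withDensity_eq_integral_toReal_smul
            (measurable_graphDensity_fderiv γ) (ae_of_all _ fun _ => ENNReal.ofReal_lt_top)]
        simp [ν, graphMap, ENNReal.toReal_ofReal (graphDensity_pos _).le]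
    _ = ∫ p, f (graphMap Ψ γ p) * (w.2 - fderiv ℝ γ p w.1) := by
        congr 1 with p
        rw [inner_frameMap_graphNormal, mul_left_comm,
          mul_inv_cancel_left₀ (graphDensity_pos _).ne']

theorem integral_fderiv (h : IsPatch B U Ψ γ L) (hB : IsOpen B) {f : E3 → ℝ}
    (hf : ContDiff ℝ 1 f) (hc : HasCompactSupport f) (hU : tsupport f ⊆ U) (v : E3) :
    ∫ y in B, fderiv ℝ f y v = ∫ y, f y * ⟪v, outerNormal B y⟫_ℝ ∂surfaceMeasure B := by
  obtain ⟨w, rfl⟩ := (frameMap Ψ).surjective v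
  have hf₀ (y : E3) (hy : y ∉ U) : f y = 0 :=
    image_eq_zero_of_notMem_tsupport fun hmem => hy (hU hmem)
  have hf₀' (y : E3) (hy : y ∉ U) : fderiv ℝ f y (frameMap Ψ w) = 0 := by
    rw [image_eq_zero_of_notMem_tsupport fun hmem => hy (hU (tsupport_fderiv_subset ℝ hmem))]
    rfl
  have hcomp (a : E2 × ℝ) :
      fderiv ℝ (f ∘ frameMap Ψ) a w = fderiv ℝ f (frameMap Ψ a) (frameMap Ψ w) := by
    rw [(frameMap Ψ).comp_right_fderiv]
    rfl
  rw [h.setIntegral_eq_subgraph hB hf₀', h.integral_surfaceMeasure_eq hB hf₀]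
  simp only [← hcomp]
  exact integral_subgraph_fderiv h.lipschitz (hf.comp (frameMap Ψ).contDiff)
    (hc.comp_homeomorph (frameMap Ψ).toHomeomorph) w

end IsPatch

end Patch

section Localization

variable {E F : Type*} [NormedAddCommGroup E] [NormedSpace ℝ E] [NormedAddCommGroup F]
  [NormedSpace ℝ F]

theorem exists_finset_sum_smoothPartitionOfUnity_smul {ι : Type*}
    (ρ : SmoothPartitionOfUnity ι (modelWithCornersSelf ℝ E) E) {f : E → F}
    (hc : HasCompactSupport f) : ∃ s : Finset ι, f = ∑ i ∈ s, fun y => ρ i y • f y := by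
  have hfin : {i | (Function.support (ρ i) ∩ tsupport f).Nonempty}.Finite :=
    ρ.locallyFinite.finite_nonempty_inter_compact hc
  refine ⟨hfin.toFinset, ?_⟩
  ext y
  rw [Finset.sum_apply, ← Finset.sum_smul]
  by_cases hy : y ∈ tsupport f
  · rw [← finsum_eq_sum_of_support_subset, ρ.sum_eq_one (mem_univ y), one_smul]
    intro i hi
    simp only [Finite.coe_toFinset, mem_ofPred_eq]
    exact ⟨y, hi, hy⟩
  · rw [image_eq_zero_of_notMem_tsupport hy, smul_zero]

theorem contDiff_hasCompactSupport_induction [FiniteDimensional ℝ E] {n : ℕ∞} {Q : (E → F) → Prop}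
    (zero : Q 0)
    (add : ∀ f g, ContDiff ℝ n f → HasCompactSupport f → ContDiff ℝ n g → HasCompactSupport g →
      Q f → Q g → Q (f + g))
    (local_nhds : ∀ z, ∃ U, IsOpen U ∧ z ∈ U ∧
      ∀ f, ContDiff ℝ n f → HasCompactSupport f → tsupport f ⊆ U → Q f)
    {f : E → F} (hf : ContDiff ℝ n f) (hc : HasCompactSupport f) : Q f := by
  choose U hUo hUm hUQ using local_nhds
  obtain ⟨ρ, hρ⟩ := SmoothPartitionOfUnity.exists_isSubordinate (modelWithCornersSelf ℝ E)
    isClosed_univ U hUo fun z _ => mem_iUnion.2 ⟨z, hUm z⟩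
  obtain ⟨s, hs⟩ := exists_finset_sum_smoothPartitionOfUnity_smul ρ hc
  have hpiece (i : E) : ContDiff ℝ n (fun y => ρ i y • f y) ∧
      HasCompactSupport (fun y => ρ i y • f y) ∧ Q (fun y => ρ i y • f y) := by
    have hsmooth : ContDiff ℝ n (fun y => ρ i y • f y) :=
      ((contMDiff_iff_contDiff.1 (ρ i).contMDiff).of_le (mod_cast le_top)).smul hf
    have hcompact : HasCompactSupport (fun y => ρ i y • f y) := hc.smul_left
    exact ⟨hsmooth, hcompact,
      hUQ i _ hsmooth hcompact ((tsupport_smul_subset_left (ρ i) f).trans (hρ i))⟩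
  suffices h : ContDiff ℝ n f ∧ HasCompactSupport f ∧ Q f from h.2.2
  rw [hs]
  refine Finset.sum_induction _ (fun g => ContDiff ℝ n g ∧ HasCompactSupport g ∧ Q g) ?_
    ⟨contDiff_const, HasCompactSupport.zero, zero⟩ fun i _ => hpiece i
  rintro g k ⟨hg, hgc, hQg⟩ ⟨hk, hkc, hQk⟩
  exact ⟨hg.add hk, hgc.add hkc, add g k hg hgc hk hkc hQg hQk⟩

end Localization

section LipschitzDomain

variable {B : Set E3}

theorem ae_mem_frontier (B : Set E3) : ∀ᵐ z ∂surfaceMeasure B, z ∈ frontier B :=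
  ae_restrict_mem isClosed_frontier.measurableSet

theorem restrict_frontier_surfaceMeasure (B : Set E3) :
    (surfaceMeasure B).restrict (frontier B) = surfaceMeasure B :=
  Measure.restrict_eq_self_of_ae_mem (ae_mem_frontier B)

theorem inner_outerNormal_le (B : Set E3) (v z : E3) : ‖⟪v, outerNormal B z⟫_ℝ‖ ≤ ‖v‖ :=
  (norm_inner_le_norm _ _).trans (mul_le_of_le_one_right (norm_nonneg _) (norm_outerNormal_le B z))

theorem integral_fderiv_apply_eq_zero {E F : Type*} [NormedAddCommGroup E] [NormedSpace ℝ E]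
    [FiniteDimensional ℝ E] [MeasurableSpace E] [BorelSpace E] [NormedAddCommGroup F]
    [NormedSpace ℝ F] {μ : Measure E} [μ.IsAddHaarMeasure] {f : E → F} (hf : ContDiff ℝ 1 f)
    (hc : HasCompactSupport f) (v : E) : ∫ y, fderiv ℝ f y v ∂μ = 0 := by
  have h := integral_smul_fderiv_eq_neg_fderiv_smul_of_integrable (𝕜 := ℝ) (μ := μ)
    (f := fun _ : E => (1 : ℝ)) (g := f) (v := v) (by simp)
    (by simpa using integrable_fderiv_apply hf hc v)
    (by simpa using hf.continuous.integrable_of_hasCompactSupport hc)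
    (fun _ _ => by fun_prop) (fun x _ => hf.differentiable one_ne_zero x)
  simpa using h

namespace IsLipschitzDomain

theorem isCompact_frontier (hB : IsLipschitzDomain B) : IsCompact (frontier B) :=
  Metric.isCompact_of_isClosed_isBounded isClosed_frontier
    (hB.isBounded.closure.subset frontier_subset_closure)

theorem aestronglyMeasurable_outerNormal (hB : IsLipschitzDomain B) :
    AEStronglyMeasurable (outerNormal B) (surfaceMeasure B) := by
  rw [← restrict_frontier_surfaceMeasure]
  refine hB.isCompact_frontier.induction_on
    (p := fun s => AEStronglyMeasurable (outerNormal B) ((surfaceMeasure B).restrict s))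
    (by simp) (fun s t hst ht => ht.mono_set hst)
    (fun s t hs ht => aestronglyMeasurable_union_iff.2 ⟨hs, ht⟩) fun z hz => ?_
  obtain ⟨U, Ψ, γ, L, hzU, hpatch⟩ := hB.exists_isPatch hz
  exact ⟨U, mem_nhdsWithin_of_mem_nhds (hpatch.isOpen.mem_nhds hzU),
    hpatch.aestronglyMeasurable_outerNormal hB.isOpen⟩

theorem isFiniteMeasure_surfaceMeasure (hB : IsLipschitzDomain B) :
    IsFiniteMeasure (surfaceMeasure B) := by
  refine ⟨?_⟩
  rw [← restrict_frontier_surfaceMeasure, Measure.restrict_apply_univ]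
  refine hB.isCompact_frontier.measure_lt_top_of_nhdsWithin fun z hz => ?_
  obtain ⟨U, Ψ, γ, L, hzU, hpatch⟩ := hB.exists_isPatch hz
  exact ⟨U, mem_nhdsWithin_of_mem_nhds (hpatch.isOpen.mem_nhds hzU),
    hpatch.surfaceMeasure_lt_top hB.isOpen⟩

theorem integrable_inner_smul {F : Type*} [NormedAddCommGroup F] [NormedSpace ℝ F]
    (hB : IsLipschitzDomain B) {f : E3 → F} (hf : Integrable f (surfaceMeasure B)) (v : E3) :
    Integrable (fun z => ⟪v, outerNormal B z⟫_ℝ • f z) (surfaceMeasure B) :=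
  hf.bdd_smul ‖v‖ (aestronglyMeasurable_const.inner hB.aestronglyMeasurable_outerNormal)
    (ae_of_all _ (inner_outerNormal_le B v))

theorem integral_fderiv_of_tsupport_subset_compl_frontier (hB : IsLipschitzDomain B) {f : E3 → ℝ}
    (hf : ContDiff ℝ 1 f) (hc : HasCompactSupport f)
    (hfr : tsupport f ⊆ B ∨ tsupport f ⊆ (closure B)ᶜ) (v : E3) :
    ∫ y in B, fderiv ℝ f y v = ∫ y, f y * ⟪v, outerNormal B y⟫_ℝ ∂surfaceMeasure B := by
  have hfderiv (y : E3) (hy : y ∉ tsupport f) : fderiv ℝ f y v = 0 := by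
    rw [image_eq_zero_of_notMem_tsupport fun hmem => hy (tsupport_fderiv_subset ℝ hmem)]
    rfl
  have hsurface : ∫ y, f y * ⟪v, outerNormal B y⟫_ℝ ∂surfaceMeasure B = 0 := by
    refine integral_eq_zero_of_ae ((ae_mem_frontier B).mono fun y hy => ?_)
    have hy_notMem : y ∉ tsupport f := fun hmem => hfr.elim
      (fun hin => (hB.isOpen.frontier_eq ▸ hy).2 (hin hmem))
      (fun hout => hout hmem (frontier_subset_closure hy))
    simp [image_eq_zero_of_notMem_tsupport hy_notMem]
  rw [hsurface]
  rcases hfr with hin | hout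
  · rw [setIntegral_eq_integral_of_forall_compl_eq_zero fun y hy => hfderiv y fun hmem =>
      hy (hin hmem), integral_fderiv_apply_eq_zero hf hc]
  · exact setIntegral_eq_zero_of_forall_eq_zero fun y hy => hfderiv y fun hmem =>
      hout hmem (subset_closure hy)

theorem integral_fderiv_real (hB : IsLipschitzDomain B) {f : E3 → ℝ}
    (hf : ContDiff ℝ 1 f) (hc : HasCompactSupport f) (v : E3) :
    ∫ y in B, fderiv ℝ f y v = ∫ y, f y * ⟪v, outerNormal B y⟫_ℝ ∂surfaceMeasure B := by
  have := hB.isFiniteMeasure_surfaceMeasure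
  have hsurface {g : E3 → ℝ} (hg : ContDiff ℝ 1 g) (hgc : HasCompactSupport g) :
      Integrable (fun y => g y * ⟪v, outerNormal B y⟫_ℝ) (surfaceMeasure B) := by
    simpa only [smul_eq_mul, mul_comm] using
      hB.integrable_inner_smul (hg.continuous.integrable_of_hasCompactSupport hgc) v
  refine contDiff_hasCompactSupport_induction (n := 1) (Q := fun f => ∫ y in B, fderiv ℝ f y v =
    ∫ y, f y * ⟪v, outerNormal B y⟫_ℝ ∂surfaceMeasure B) (by simp) ?_ (fun z => ?_) hf hc
  · intro g k hg hgc hk hkc hQg hQk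
    have hadd (y : E3) : fderiv ℝ (g + k) y v = fderiv ℝ g y v + fderiv ℝ k y v := by
      rw [fderiv_add (hg.differentiable one_ne_zero y) (hk.differentiable one_ne_zero y)]
      rfl
    simp only [hadd, Pi.add_apply, add_mul]
    rw [integral_add (integrable_fderiv_apply hg hgc v) (integrable_fderiv_apply hk hkc v),
      integral_add (hsurface hg hgc) (hsurface hk hkc), hQg, hQk]
  · by_cases hz : z ∈ frontier B
    · obtain ⟨U, Ψ, γ, L, hzU, hpatch⟩ := hB.exists_isPatch hz
      exact ⟨U, hpatch.isOpen, hzU, fun g hg hgc hgU =>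
        hpatch.integral_fderiv hB.isOpen hg hgc hgU v⟩
    by_cases hzB : z ∈ B
    · exact ⟨B, hB.isOpen, hzB, fun g hg hgc hgB =>
        hB.integral_fderiv_of_tsupport_subset_compl_frontier hg hgc (.inl hgB) v⟩
    · refine ⟨(closure B)ᶜ, isClosed_closure.isOpen_compl, fun hcl => hz ?_, fun g hg hgc hgB =>
        hB.integral_fderiv_of_tsupport_subset_compl_frontier hg hgc (.inr hgB) v⟩
      exact hB.isOpen.frontier_eq ▸ ⟨hcl, hzB⟩

theorem integral_fderiv {F : Type*} [NormedAddCommGroup F] [NormedSpace ℝ F] [CompleteSpace F]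
    (hB : IsLipschitzDomain B) {f : E3 → F} (hf : ContDiff ℝ 1 f) (hc : HasCompactSupport f)
    (v : E3) :
    ∫ y in B, fderiv ℝ f y v = ∫ y, ⟪v, outerNormal B y⟫_ℝ • f y ∂surfaceMeasure B := by
  have := hB.isFiniteMeasure_surfaceMeasure
  refine (SeparatingDual.eq_iff_forall_dual_eq (R := ℝ)).2 fun ℓ => ?_
  have hcomp (y : E3) : fderiv ℝ (ℓ ∘ f) y v = ℓ (fderiv ℝ f y v) :=
    congrArg (· v) (ℓ.hasFDerivAt.comp y (hf.differentiable one_ne_zero y).hasFDerivAt).fderiv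
  rw [← ℓ.integral_comp_comm (integrable_fderiv_apply hf hc v), ← ℓ.integral_comp_comm
    (hB.integrable_inner_smul (hf.continuous.integrable_of_hasCompactSupport hc) v)]
  simp only [← hcomp, map_smul, smul_eq_mul]
  rw [hB.integral_fderiv_real (ℓ.contDiff.comp hf) (hc.comp_left (map_zero ℓ))]
  simp only [Function.comp_apply, mul_comm]

end IsLipschitzDomain

end LipschitzDomain

section Divergence

variable {E F : Type*} [NormedAddCommGroup E] [InnerProductSpace ℝ E] [FiniteDimensional ℝ E]
  [NormedAddCommGroup F] [NormedSpace ℝ F]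

/-- The divergence of a field of linear forms, that is, of the vector field which corresponds to it
under the inner product when the values are scalars. -/
def divergence (X : E → E →L[ℝ] F) (y : E) : F :=
  ∑ i, fderiv ℝ X y (stdOrthonormalBasis ℝ E i) (stdOrthonormalBasis ℝ E i)

theorem divergence_fderiv (u : E → F) (y : E) :
    divergence (fderiv ℝ u) y = Laplacian.laplacian u y := by
  rw [divergence, InnerProductSpace.laplacian_eq_iteratedFDeriv_stdOrthonormalBasis]
  simp [iteratedFDeriv_two_apply]

theorem divergence_congr {X Y : E → E →L[ℝ] F} {y : E} (h : X =ᶠ[𝓝 y] Y) :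
    divergence X y = divergence Y y := by
  rw [divergence, divergence, h.fderiv_eq]

theorem divergence_sub {X Y : E → E →L[ℝ] F} {y : E} (hX : DifferentiableAt ℝ X y)
    (hY : DifferentiableAt ℝ Y y) :
    divergence (fun y => X y - Y y) y = divergence X y - divergence Y y := by
  simp [divergence, fderiv_fun_sub hX hY]

theorem divergence_smul {𝕜 : Type*} [NontriviallyNormedField 𝕜] [NormedAlgebra ℝ 𝕜]
    [NormedSpace 𝕜 F] [IsScalarTower ℝ 𝕜 F] {c : E → 𝕜} {X : E → E →L[ℝ] F} {y : E}
    (hc : DifferentiableAt ℝ c y) (hX : DifferentiableAt ℝ X y) :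
    divergence (fun y => c y • X y) y = ∑ i, fderiv ℝ c y (stdOrthonormalBasis ℝ E i) •
      X y (stdOrthonormalBasis ℝ E i) + c y • divergence X y := by
  simp only [divergence, fderiv_fun_smul hc hX, Finset.smul_sum, ← Finset.sum_add_distrib]
  simp [add_comm]

theorem sum_fderiv_smul_basis {ι : Type*} [Fintype ι] (b : OrthonormalBasis ι ℝ E) (φ : E → ℝ)
    (y : E) : ∑ i, fderiv ℝ φ y (b i) • b i = ∇ φ y := by
  conv_rhs => rw [← b.sum_repr (∇ φ y)]
  refine Finset.sum_congr rfl fun i _ => ?_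
  rw [b.repr_apply_apply, real_inner_comm, ← toDual_gradient, InnerProductSpace.toDual_apply_apply]

theorem divergence_real_smul {φ : E → ℝ} {X : E → E →L[ℝ] F} {y : E}
    (hφ : DifferentiableAt ℝ φ y) (hX : DifferentiableAt ℝ X y) :
    divergence (fun y => φ y • X y) y = X y (∇ φ y) + φ y • divergence X y := by
  simp only [divergence_smul hφ hX, ← map_smul, ← map_sum, sum_fderiv_smul_basis]

theorem divergence_inner_smulRight {c : E → F} {y : E} (hc : DifferentiableAt ℝ c y) (d : E) :
    divergence (fun y => (innerSL ℝ d).smulRight (c y)) y = fderiv ℝ c y d := by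
  have hfield : HasFDerivAt (fun y => (innerSL ℝ d).smulRight (c y))
      ((ContinuousLinearMap.smulRightL ℝ E F (innerSL ℝ d)).comp (fderiv ℝ c y)) y :=
    (ContinuousLinearMap.smulRightL ℝ E F (innerSL ℝ d)).hasFDerivAt.comp y hc.hasFDerivAt
  rw [divergence, hfield.fderiv]
  conv_rhs => rw [← (stdOrthonormalBasis ℝ E).sum_repr d, map_sum]
  simp [(stdOrthonormalBasis ℝ E).repr_apply_apply, real_inner_comm]

theorem divergence_radial {c : E → F} {x y : E} (hc : DifferentiableAt ℝ c y) :
    divergence (fun y => (innerSL ℝ (y - x)).smulRight (c y)) y =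
      fderiv ℝ c y (y - x) + Module.finrank ℝ E • c y := by
  let innerL : E →L[ℝ] E →L[ℝ] ℝ := innerSL ℝ
  have innerL_apply (v w : E) : innerL v w = ⟪v, w⟫_ℝ := rfl
  have hinner : HasFDerivAt (fun y => innerL (y - x)) innerL y :=
    innerL.hasFDerivAt.comp y ((hasFDerivAt_id y).sub_const x)
  have hsmulRight := isBoundedBilinearMap_smulRight (𝕜 := ℝ) (E := E) (F := F)
  have hfield : HasFDerivAt (fun y => (innerL (y - x)).smulRight (c y)) _ y :=
    (hsmulRight.hasFDerivAt (innerL (y - x), c y)).comp (f := fun y => (innerL (y - x), c y)) y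
      (hinner.prodMk hc.hasFDerivAt)
  rw [divergence, hfield.fderiv]
  conv_rhs => rw [← (stdOrthonormalBasis ℝ E).sum_repr (y - x), map_sum]
  simp [(stdOrthonormalBasis ℝ E).repr_apply_apply, real_inner_comm, Finset.sum_add_distrib,
    innerL_apply]

end Divergence

theorem fderiv_apply_apply {E F : Type*} [NormedAddCommGroup E] [NormedSpace ℝ E]
    [NormedAddCommGroup F] [NormedSpace ℝ F] {X : E → E →L[ℝ] F} {y : E}
    (hX : DifferentiableAt ℝ X y) (v w : E) :
    fderiv ℝ X y v w = fderiv ℝ (fun z => X z w) y v := by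
  rw [(hX.hasFDerivAt.clm_apply (hasFDerivAt_const w y)).fderiv]
  simp

theorem hasCompactSupport_apply {E F : Type*} [NormedAddCommGroup E] [NormedSpace ℝ E]
    [NormedAddCommGroup F] [NormedSpace ℝ F] {X : E → E →L[ℝ] F} (hc : HasCompactSupport X)
    (v : E) : HasCompactSupport fun y => X y v :=
  hc.comp_left (g := fun A : E →L[ℝ] F => A v) rfl

section GaussTheorem

variable {E F : Type*} [NormedAddCommGroup E] [InnerProductSpace ℝ E] [FiniteDimensional ℝ E]
  [NormedAddCommGroup F] [NormedSpace ℝ F] {X : E → E →L[ℝ] F}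

theorem divergence_eq_sum_fderiv_apply (hX : ContDiff ℝ 1 X) (y : E) :
    divergence X y = ∑ i, fderiv ℝ (fun z => X z (stdOrthonormalBasis ℝ E i)) y
      (stdOrthonormalBasis ℝ E i) :=
  Finset.sum_congr rfl fun _ _ => fderiv_apply_apply (hX.differentiable one_ne_zero y) _ _

variable [MeasurableSpace E] [BorelSpace E]

theorem integrable_divergence {μ : Measure E} [IsFiniteMeasureOnCompacts μ]
    (hX : ContDiff ℝ 1 X) (hc : HasCompactSupport X) : Integrable (divergence X) μ := by
  simp only [funext (divergence_eq_sum_fderiv_apply hX)]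
  exact integrable_finsetSum _ fun i _ => integrable_fderiv_apply
    (hX.clm_apply contDiff_const) (hasCompactSupport_apply hc _) _

theorem integral_divergence_eq_zero {μ : Measure E} [μ.IsAddHaarMeasure]
    (hX : ContDiff ℝ 1 X) (hc : HasCompactSupport X) : ∫ y, divergence X y ∂μ = 0 := by
  have hcomp (w : E) : ContDiff ℝ 1 fun y => X y w := hX.clm_apply contDiff_const
  have hcompc (w : E) : HasCompactSupport fun y => X y w := hasCompactSupport_apply hc w
  simp only [divergence_eq_sum_fderiv_apply hX]
  rw [integral_finsetSum _ fun i _ => integrable_fderiv_apply (hcomp _) (hcompc _) _]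
  exact Finset.sum_eq_zero fun i _ => integral_fderiv_apply_eq_zero (hcomp _) (hcompc _) _

theorem IsLipschitzDomain.integral_divergence {B : Set E3} (hB : IsLipschitzDomain B)
    [CompleteSpace F] {X : E3 → E3 →L[ℝ] F} (hX : ContDiff ℝ 1 X) (hc : HasCompactSupport X) :
    ∫ y in B, divergence X y = ∫ z, X z (outerNormal B z) ∂surfaceMeasure B := by
  have := hB.isFiniteMeasure_surfaceMeasure
  have hcomp (w : E3) : ContDiff ℝ 1 fun y => X y w := hX.clm_apply contDiff_const
  have hcompc (w : E3) : HasCompactSupport fun y => X y w := hasCompactSupport_apply hc w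
  simp only [divergence_eq_sum_fderiv_apply hX]
  rw [integral_finsetSum _ fun i _ =>
      (integrable_fderiv_apply (hcomp _) (hcompc _) _).integrableOn,
    Finset.sum_congr rfl fun i _ => hB.integral_fderiv (hcomp _) (hcompc _) _,
    ← integral_finsetSum _ fun i _ => hB.integrable_inner_smul
      ((hcomp _).continuous.integrable_of_hasCompactSupport (hcompc _)) _]
  refine integral_congr_ae (ae_of_all _ fun z => ?_)
  simp only [← map_smul, ← map_sum, ← (stdOrthonormalBasis ℝ E3).repr_apply_apply,
    OrthonormalBasis.sum_repr]

end GaussTheorem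

section Helmholtz

variable {E : Type*} [NormedAddCommGroup E] [InnerProductSpace ℝ E]

/-- The linear form `u ∇w - w ∇u` at the point `y`, to which Green's second formula applies the
outward unit normal. -/
def flux (u w : E → ℂ) (y : E) : E →L[ℝ] ℂ := u y • fderiv ℝ w y - w y • fderiv ℝ u y

theorem flux_apply (u w : E → ℂ) (y v : E) :
    flux u w y v = u y * fderiv ℝ w y v - w y * fderiv ℝ u y v := by
  simp [flux]

theorem support_smul_flux_subset (φ : E → ℝ) (u w : E → ℂ) :
    Function.support (fun y => φ y • flux u w y) ⊆ Function.support φ :=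
  fun y hy (h : φ y = 0) => hy <| ContinuousLinearMap.ext fun v => by simp [h]

variable [FiniteDimensional ℝ E]

/-- `u` is a classical solution of the Helmholtz equation `Δu + κ²u = 0` in the open set `U`. -/
structure IsHelmholtzOn (κ : ℝ) (U : Set E) (u : E → ℂ) : Prop where
  isOpen : IsOpen U
  contDiffOn : ContDiffOn ℝ 2 u U
  laplacian_eq : ∀ y ∈ U, Laplacian.laplacian u y = -(κ : ℂ) ^ 2 * u y

variable {κ : ℝ} {U : Set E} {u w : E → ℂ} {φ : E → ℝ} {y : E}

namespace IsHelmholtzOn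

theorem mono (hu : IsHelmholtzOn κ U u) {V : Set E} (hV : IsOpen V) (h : V ⊆ U) :
    IsHelmholtzOn κ V u :=
  ⟨hV, hu.contDiffOn.mono h, fun y hy => hu.laplacian_eq y (h hy)⟩

theorem contDiffAt (hu : IsHelmholtzOn κ U u) (hy : y ∈ U) : ContDiffAt ℝ 2 u y :=
  hu.contDiffOn.contDiffAt (hu.isOpen.mem_nhds hy)

theorem differentiableAt (hu : IsHelmholtzOn κ U u) (hy : y ∈ U) : DifferentiableAt ℝ u y :=
  (hu.contDiffAt hy).differentiableAt two_ne_zero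

theorem contDiffAt_fderiv (hu : IsHelmholtzOn κ U u) (hy : y ∈ U) :
    ContDiffAt ℝ 1 (fderiv ℝ u) y :=
  (hu.contDiffAt hy).fderiv_right (by norm_num)

theorem continuousOn (hu : IsHelmholtzOn κ U u) : ContinuousOn u U := hu.contDiffOn.continuousOn

theorem continuousOn_fderiv (hu : IsHelmholtzOn κ U u) : ContinuousOn (fderiv ℝ u) U :=
  fun _ hy => (hu.contDiffAt_fderiv hy).continuousAt.continuousWithinAt

theorem conjugate (hu : IsHelmholtzOn κ U u) : IsHelmholtzOn κ U (fun y => conj (u y)) := by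
  refine ⟨hu.isOpen, Complex.conjCLE.contDiff.comp_contDiffOn hu.contDiffOn, fun y hy => ?_⟩
  have hcomp : Laplacian.laplacian (fun y => conj (u y)) y = _ :=
    (hu.contDiffAt hy).laplacian_CLM_comp_left (l := (Complex.conjCLE : ℂ →L[ℝ] ℂ))
  rw [hcomp, Function.comp_apply, hu.laplacian_eq y hy]
  simp

theorem continuousOn_flux (hu : IsHelmholtzOn κ U u) (hw : IsHelmholtzOn κ U w) :
    ContinuousOn (flux u w) U :=
  (hu.continuousOn.smul hw.continuousOn_fderiv).sub (hw.continuousOn.smul hu.continuousOn_fderiv)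

theorem contDiffAt_flux (hu : IsHelmholtzOn κ U u) (hw : IsHelmholtzOn κ U w) (hy : y ∈ U) :
    ContDiffAt ℝ 1 (flux u w) y :=
  (((hu.contDiffAt hy).of_le one_le_two).smul (hw.contDiffAt_fderiv hy)).sub
    (((hw.contDiffAt hy).of_le one_le_two).smul (hu.contDiffAt_fderiv hy))

theorem contDiff_smul_flux (hu : IsHelmholtzOn κ U u) (hw : IsHelmholtzOn κ U w)
    (hφ : ContDiff ℝ 1 φ) (hU : tsupport φ ⊆ U) : ContDiff ℝ 1 fun y => φ y • flux u w y :=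
  contMDiff_iff_contDiff.1 <| contMDiff_of_tsupport fun _ hy => contMDiffAt_iff_contDiffAt.2 <|
    hφ.contDiffAt.smul <|
      hu.contDiffAt_flux hw (hU (closure_mono (support_smul_flux_subset φ u w) hy))

theorem divergence_flux (hu : IsHelmholtzOn κ U u) (hw : IsHelmholtzOn κ U w) (hy : y ∈ U) :
    divergence (flux u w) y = 0 := by
  have hud := hu.differentiableAt hy
  have hwd := hw.differentiableAt hy
  have hud' := (hu.contDiffAt_fderiv hy).differentiableAt one_ne_zero
  have hwd' := (hw.contDiffAt_fderiv hy).differentiableAt one_ne_zero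
  have hdiv : divergence (flux u w) y = divergence (fun y => u y • fderiv ℝ w y) y -
      divergence (fun y => w y • fderiv ℝ u y) y :=
    divergence_sub (hud.smul hwd') (hwd.smul hud')
  rw [hdiv, divergence_smul hud hwd', divergence_smul hwd hud', divergence_fderiv,
    divergence_fderiv, hu.laplacian_eq y hy, hw.laplacian_eq y hy]
  simp only [smul_eq_mul, mul_comm (fderiv ℝ u y _)]
  ring

theorem divergence_smul_flux (hu : IsHelmholtzOn κ U u) (hw : IsHelmholtzOn κ U w)
    (hφ : ContDiff ℝ 1 φ) (hU : tsupport φ ⊆ U) (y : E) :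
    divergence (fun y => φ y • flux u w y) y = flux u w y (∇ φ y) := by
  by_cases hy : y ∈ tsupport φ
  · rw [divergence_real_smul (hφ.differentiable one_ne_zero y)
      ((hu.contDiffAt_flux hw (hU hy)).differentiableAt one_ne_zero),
      hu.divergence_flux hw (hU hy), smul_zero, add_zero]
  · have hzero : (fun y => φ y • flux u w y) =ᶠ[𝓝 y] fun _ => 0 :=
      notMem_tsupport_iff_eventuallyEq.1 fun h =>
        hy (closure_mono (support_smul_flux_subset φ u w) h)
    have hgrad : ∇ φ y = 0 := by
      rw [gradient, image_eq_zero_of_notMem_tsupport fun h => hy (tsupport_fderiv_subset ℝ h),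
        map_zero]
    rw [divergence_congr hzero, hgrad]
    simp [divergence]

variable [MeasurableSpace E] [BorelSpace E]

theorem integrable_flux_gradient {μ : Measure E} [IsFiniteMeasureOnCompacts μ]
    (hu : IsHelmholtzOn κ U u) (hw : IsHelmholtzOn κ U w)
    (hφ : ContDiff ℝ 1 φ) (hc : HasCompactSupport φ) (hU : tsupport φ ⊆ U) :
    Integrable (fun y => flux u w y (∇ φ y)) μ := by
  simp only [← divergence_smul_flux hu hw hφ hU]
  exact integrable_divergence (hu.contDiff_smul_flux hw hφ hU) hc.smul_right

theorem integral_flux_gradient_eq_zero {μ : Measure E} [μ.IsAddHaarMeasure]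
    (hu : IsHelmholtzOn κ U u) (hw : IsHelmholtzOn κ U w)
    (hφ : ContDiff ℝ 1 φ) (hc : HasCompactSupport φ) (hU : tsupport φ ⊆ U) :
    ∫ y, flux u w y (∇ φ y) ∂μ = 0 := by
  simp only [← divergence_smul_flux hu hw hφ hU]
  exact integral_divergence_eq_zero (hu.contDiff_smul_flux hw hφ hU) hc.smul_right

end IsHelmholtzOn

theorem IsLipschitzDomain.integral_compl_flux_gradient {B : Set E3} (hB : IsLipschitzDomain B)
    {U : Set E3} {u w : E3 → ℂ} {φ : E3 → ℝ} (hu : IsHelmholtzOn κ U u)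
    (hw : IsHelmholtzOn κ U w) (hφ : ContDiff ℝ 1 φ) (hc : HasCompactSupport φ)
    (hU : tsupport φ ⊆ U) (hφ1 : ∀ z ∈ frontier B, φ z = 1) :
    ∫ y in Bᶜ, flux u w y (∇ φ y) = -∫ z, flux u w z (outerNormal B z) ∂surfaceMeasure B := by
  have hinside : ∫ y in B, flux u w y (∇ φ y) =
      ∫ z, flux u w z (outerNormal B z) ∂surfaceMeasure B := by
    simp only [← hu.divergence_smul_flux hw hφ hU]
    rw [hB.integral_divergence (hu.contDiff_smul_flux hw hφ hU) hc.smul_right]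
    exact integral_congr_ae ((ae_mem_frontier B).mono fun z hz => by simp [hφ1 z hz])
  rw [← hinside, eq_neg_iff_add_eq_zero, add_comm,
    integral_add_compl hB.isOpen.measurableSet (hu.integrable_flux_gradient hw hφ hc hU),
    hu.integral_flux_gradient_eq_zero hw hφ hc hU]

end Helmholtz

section PlaneWave

theorem hasFDerivAt_planeWave (κ : ℝ) (d y : E3) :
    HasFDerivAt (planeWave κ d)
      ((innerSL ℝ d).smulRight (Complex.I * κ * planeWave κ d y)) y := by
  have hphase : HasFDerivAt (fun y => ((κ * ⟪d, y⟫_ℝ : ℝ) : ℂ))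
      (Complex.ofRealCLM.comp (κ • innerSL ℝ d)) y :=
    Complex.ofRealCLM.hasFDerivAt.comp y ((innerSL ℝ d).hasFDerivAt.const_mul κ)
  have hexp : HasFDerivAt (planeWave κ d) _ y := (hphase.const_mul Complex.I).cexp
  refine hexp.congr_fderiv ?_
  ext v
  simp only [planeWave, Complex.ofReal_mul, smul_apply, ContinuousLinearMap.comp_apply,
    ContinuousLinearMap.smulRight_apply, innerSL_apply_apply, Complex.ofRealCLM_apply,
    Complex.real_smul, smul_eq_mul]
  ring

theorem contDiff_planeWave (κ : ℝ) (d : E3) : ContDiff ℝ 2 (planeWave κ d) := by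
  have hphase : ContDiff ℝ 2 fun y : E3 => ((κ * ⟪d, y⟫_ℝ : ℝ) : ℂ) :=
    Complex.ofRealCLM.contDiff.comp (contDiff_const.mul (contDiff_const.inner ℝ contDiff_id))
  exact (contDiff_const.mul hphase).cexp

theorem isHelmholtzOn_planeWave (κ : ℝ) {d : E3} (hd : ‖d‖ = 1) :
    IsHelmholtzOn κ univ (planeWave κ d) := by
  refine ⟨isOpen_univ, (contDiff_planeWave κ d).contDiffOn, fun y _ => ?_⟩
  have hfderiv : fderiv ℝ (planeWave κ d) = fun y =>
      (innerSL ℝ d).smulRight (Complex.I * κ * planeWave κ d y) :=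
    funext fun y => (hasFDerivAt_planeWave κ d y).fderiv
  have hcoeff := (hasFDerivAt_planeWave κ d y).const_mul (Complex.I * κ)
  rw [← divergence_fderiv, hfderiv, divergence_inner_smulRight hcoeff.differentiableAt,
    hcoeff.fderiv]
  simp only [smul_apply, ContinuousLinearMap.smulRight_apply, innerSL_apply_apply,
    real_inner_self_eq_norm_sq, hd, one_pow, one_smul, smul_eq_mul]
  linear_combination (κ : ℂ) ^ 2 * planeWave κ d y * Complex.I_sq

end PlaneWave

section GreenFunction

/-- The radial derivative of the fundamental solution divided by the radius, so that
`∇_z Φ(x, z) = greenSlope κ |x - z| • (z - x)`. -/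
def greenSlope (κ r : ℝ) : ℂ :=
  Complex.exp (Complex.I * (κ * r : ℝ)) * (Complex.I * κ * r - 1) / (4 * Real.pi * r ^ 3 : ℝ)

theorem hasDerivAt_cexp_mul (κ r : ℝ) :
    HasDerivAt (fun r : ℝ => Complex.exp (Complex.I * (κ * r : ℝ)))
      (Complex.I * κ * Complex.exp (Complex.I * (κ * r : ℝ))) r := by
  have hphase : HasDerivAt (fun r : ℝ => Complex.I * ((κ * r : ℝ) : ℂ)) (Complex.I * κ) r := by
    simpa using ((hasDerivAt_id r).const_mul κ).ofReal_comp.const_mul Complex.I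
  simpa only [mul_comm] using hphase.cexp

theorem hasDerivAt_greenSlope (κ : ℝ) {r : ℝ} (hr : r ≠ 0) :
    HasDerivAt (greenSlope κ) (Complex.exp (Complex.I * (κ * r : ℝ)) *
      (3 - 3 * Complex.I * κ * r - κ ^ 2 * r ^ 2) / (4 * Real.pi * r ^ 4)) r := by
  have hrc : (r : ℂ) ≠ 0 := by exact_mod_cast hr
  have hpi : (Real.pi : ℂ) ≠ 0 := by exact_mod_cast Real.pi_ne_zero
  have hdenom : HasDerivAt (fun r : ℝ => ((4 * Real.pi * r ^ 3 : ℝ) : ℂ))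
      (12 * Real.pi * r ^ 2 : ℂ) r := by
    convert ((hasDerivAt_pow 3 r).const_mul (4 * Real.pi)).ofReal_comp using 1
    push_cast
    ring
  have hfactor : HasDerivAt (fun r : ℝ => (Complex.I * κ * r - 1 : ℂ)) (Complex.I * κ) r := by
    simpa using ((hasDerivAt_id r).ofReal_comp.const_mul (Complex.I * κ)).sub_const 1
  refine (((hasDerivAt_cexp_mul κ r).mul hfactor).div hdenom
    (by push_cast; simp [hrc, hpi])).congr_deriv ?_
  rw [Pi.mul_apply]
  push_cast
  field_simp
  ring_nf
  simp only [Complex.I_sq]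
  ring

theorem hasFDerivAt_norm_sub {E : Type*} [NormedAddCommGroup E] [InnerProductSpace ℝ E] {x z : E}
    (hz : z ≠ x) : HasFDerivAt (fun z => ‖x - z‖) (‖x - z‖⁻¹ • innerSL ℝ (z - x)) z := by
  have hne : ‖z - x‖ ^ 2 ≠ 0 := by simpa [sub_eq_zero] using hz
  have hsqrt := ((hasFDerivAt_id z).sub_const x).norm_sq.sqrt hne
  simp only [norm_sub_rev x, id, Real.sqrt_sq (norm_nonneg _)] at hsqrt ⊢
  refine hsqrt.congr_fderiv ?_
  ext v
  simp only [ContinuousLinearMap.comp_id, smul_apply, innerSL_apply_apply, nsmul_eq_mul,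
    smul_eq_mul]
  push_cast
  field_simp

theorem hasFDerivAt_greenFun (κ : ℝ) {x z : E3} (hz : z ≠ x) :
    HasFDerivAt (greenFun κ x) ((innerSL ℝ (z - x)).smulRight (greenSlope κ ‖x - z‖)) z := by
  have hnorm : ‖x - z‖ ≠ 0 := norm_ne_zero_iff.2 (sub_ne_zero.2 hz.symm)
  have hnormc : (‖x - z‖ : ℂ) ≠ 0 := by exact_mod_cast hnorm
  have hpi : (Real.pi : ℂ) ≠ 0 := by exact_mod_cast Real.pi_ne_zero
  have hdenom : HasDerivAt (fun r : ℝ => ((4 * Real.pi * r : ℝ) : ℂ)) (4 * Real.pi : ℂ)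
      ‖x - z‖ := by
    simpa using ((hasDerivAt_id ‖x - z‖).const_mul (4 * Real.pi)).ofReal_comp
  have hradial := (hasDerivAt_cexp_mul κ ‖x - z‖).div hdenom (by push_cast; simp [hnormc, hpi])
  refine (hradial.hasFDerivAt.comp z (hasFDerivAt_norm_sub hz)).congr_fderiv ?_
  ext v
  simp only [ContinuousLinearMap.smulRight_apply, smul_apply, Complex.real_smul, greenSlope,
    smul_eq_mul, ContinuousLinearMap.comp_apply, ContinuousLinearMap.toSpanSingleton_apply]
  push_cast
  field_simp

theorem contDiffAt_greenFun (κ : ℝ) {x z : E3} (hz : z ≠ x) : ContDiffAt ℝ 2 (greenFun κ x) z := by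
  have hne : x - z ≠ 0 := sub_ne_zero.2 hz.symm
  have hmul (c : ℝ) : ContDiffAt ℝ 2 (fun z => ((c * ‖x - z‖ : ℝ) : ℂ)) z :=
    Complex.ofRealCLM.contDiff.contDiffAt.comp z
      (contDiffAt_const.mul ((contDiffAt_const.sub contDiffAt_id).norm ℝ hne))
  have hdenom : ((4 * Real.pi * ‖x - z‖ : ℝ) : ℂ) ≠ 0 := by
    exact_mod_cast mul_ne_zero (by positivity) (norm_ne_zero_iff.2 hne)
  unfold greenFun
  simp only [div_eq_mul_inv]
  exact (contDiffAt_const.mul (hmul κ)).cexp.mul ((hmul _).inv hdenom)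

theorem isHelmholtzOn_greenFun (κ : ℝ) (x : E3) : IsHelmholtzOn κ {x}ᶜ (greenFun κ x) := by
  refine ⟨isOpen_compl_singleton, fun z hz => (contDiffAt_greenFun κ hz).contDiffWithinAt,
    fun z hz => ?_⟩
  have hnorm : ‖x - z‖ ≠ 0 := norm_ne_zero_iff.2 (sub_ne_zero.2 (Ne.symm hz))
  have hnormc : (‖x - z‖ : ℂ) ≠ 0 := by exact_mod_cast hnorm
  have hpi : (Real.pi : ℂ) ≠ 0 := by exact_mod_cast Real.pi_ne_zero
  have hfderiv : fderiv ℝ (greenFun κ x) =ᶠ[𝓝 z]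
      fun y => (innerSL ℝ (y - x)).smulRight (greenSlope κ ‖x - y‖) :=
    mem_of_superset (isOpen_compl_singleton.mem_nhds hz) fun y hy =>
      (hasFDerivAt_greenFun κ hy).fderiv
  have hslope : HasFDerivAt (fun y => greenSlope κ ‖x - y‖) _ z :=
    HasFDerivAt.comp z (f := fun y => ‖x - y‖) (hasDerivAt_greenSlope κ hnorm).hasFDerivAt
      (hasFDerivAt_norm_sub hz)
  rw [← divergence_fderiv, divergence_congr hfderiv, divergence_radial hslope.differentiableAt,
    hslope.fderiv]
  simp only [ContinuousLinearMap.comp_apply, ContinuousLinearMap.toSpanSingleton_apply, smul_apply,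
    innerSL_apply_apply, real_inner_self_eq_norm_sq, norm_sub_rev z x, finrank_euclideanSpace,
    Fintype.card_fin, Complex.real_smul, smul_eq_mul, nsmul_eq_mul, greenSlope, greenFun]
  push_cast
  field_simp
  ring

end GreenFunction

section Cutoff

/-- A smooth cutoff function, equal to `1` on `(-∞, 1]` and to `0` on `[2, ∞)`. -/
def cutoff (t : ℝ) : ℝ := Real.smoothTransition (2 - t)

theorem contDiff_cutoff {n : ℕ∞} : ContDiff ℝ n cutoff :=
  Real.smoothTransition.contDiff.comp (contDiff_const.sub contDiff_id)

theorem cutoff_eq_one {t : ℝ} (ht : t ≤ 1) : cutoff t = 1 :=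
  Real.smoothTransition.one_of_one_le (by linarith)

theorem cutoff_eq_zero {t : ℝ} (ht : 2 ≤ t) : cutoff t = 0 :=
  Real.smoothTransition.zero_of_nonpos (by linarith)

theorem antitone_cutoff : Antitone cutoff := fun _ _ h =>
  Real.smoothTransition.monotone (by linarith)

theorem hasDerivAt_cutoff (t : ℝ) : HasDerivAt cutoff (deriv cutoff t) t :=
  ((contDiff_cutoff (n := 1)).differentiable one_ne_zero t).hasDerivAt

theorem continuous_deriv_cutoff : Continuous (deriv cutoff) :=
  (contDiff_cutoff (n := 1)).continuous_deriv le_rfl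

theorem deriv_cutoff_nonpos (t : ℝ) : deriv cutoff t ≤ 0 := antitone_cutoff.deriv_nonpos

theorem deriv_cutoff_of_lt {t : ℝ} (ht : t < 1) : deriv cutoff t = 0 := by
  have hconst : cutoff =ᶠ[𝓝 t] fun _ => 1 :=
    mem_of_superset (Iio_mem_nhds ht) fun _ hs => cutoff_eq_one (le_of_lt hs)
  rw [hconst.deriv_eq, deriv_const]

theorem deriv_cutoff_of_gt {t : ℝ} (ht : 2 < t) : deriv cutoff t = 0 := by
  have hconst : cutoff =ᶠ[𝓝 t] fun _ => 0 :=
    mem_of_superset (Ioi_mem_nhds ht) fun _ hs => cutoff_eq_zero (le_of_lt hs)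
  rw [hconst.deriv_eq, deriv_const]

theorem hasCompactSupport_deriv_cutoff_sq :
    HasCompactSupport fun r : ℝ => r * deriv cutoff (r ^ 2) :=
  HasCompactSupport.intro (isCompact_Icc (a := -2) (b := 2)) fun r hr => by
    have hsq : 2 < r ^ 2 := by
      rw [mem_Icc, ← abs_le, not_le] at hr
      rw [← sq_abs]
      nlinarith
    rw [deriv_cutoff_of_gt hsq, mul_zero]

theorem integral_mul_deriv_cutoff_sq :
    ∫ r in Ioi (0 : ℝ), r * deriv cutoff (r ^ 2) = -(1 / 2) := by
  have hderiv (r : ℝ) :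
      HasDerivAt (fun r => cutoff (r ^ 2) / 2) (r * deriv cutoff (r ^ 2)) r := by
    refine (((hasDerivAt_cutoff (r ^ 2)).comp r (hasDerivAt_pow 2 r)).div_const 2).congr_deriv ?_
    push_cast
    ring
  have hcont : Continuous fun r : ℝ => r * deriv cutoff (r ^ 2) :=
    continuous_id.mul (continuous_deriv_cutoff.comp (continuous_pow 2))
  have hlim : Tendsto (fun r : ℝ => cutoff (r ^ 2) / 2) atTop (𝓝 0) := by
    refine tendsto_const_nhds.congr' ?_
    filter_upwards [eventually_ge_atTop 2] with r hr
    rw [cutoff_eq_zero (by nlinarith), zero_div]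
  rw [integral_Ioi_of_hasDerivAt_of_tendsto' (fun r _ => hderiv r)
    (hcont.integrable_of_hasCompactSupport hasCompactSupport_deriv_cutoff_sq).integrableOn hlim]
  norm_num [cutoff_eq_one]

end Cutoff

section RadialCutoff

variable {E : Type*} [NormedAddCommGroup E]

/-- The radial cutoff function around `c` at scale `R`, equal to `1` on the ball of radius `R` and
to `0` outside the ball of radius `2 * R`; the squares make it smooth at `c`. -/
def radialCutoff (c : E) (R : ℝ) (y : E) : ℝ := cutoff (‖y - c‖ ^ 2 / R ^ 2)

variable {c y : E} {R : ℝ}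

theorem radialCutoff_eq_one (hR : 0 < R) (h : ‖y - c‖ ≤ R) : radialCutoff c R y = 1 := by
  refine cutoff_eq_one ?_
  rw [div_le_one (by positivity)]
  gcongr

theorem radialCutoff_eq_zero (hR : 0 < R) (h : 2 * R ≤ ‖y - c‖) : radialCutoff c R y = 0 := by
  refine cutoff_eq_zero ?_
  rw [le_div_iff₀ (by positivity)]
  nlinarith

theorem tsupport_radialCutoff_subset (hR : 0 < R) :
    tsupport (radialCutoff c R) ⊆ Metric.closedBall c (2 * R) := by
  refine closure_minimal (fun y hy => ?_) Metric.isClosed_closedBall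
  rw [mem_closedBall_iff_norm]
  by_contra! h
  exact hy (radialCutoff_eq_zero hR h.le)

theorem hasCompactSupport_radialCutoff [ProperSpace E] (hR : 0 < R) :
    HasCompactSupport (radialCutoff c R) :=
  (isCompact_closedBall c (2 * R)).of_isClosed_subset isClosed_closure
    (tsupport_radialCutoff_subset hR)

theorem deriv_cutoff_radial_eq_zero (hR : 0 < R)
    (h : y ∉ Metric.closedBall c (2 * R) \ Metric.ball c R) :
    deriv cutoff (‖y - c‖ ^ 2 / R ^ 2) = 0 := by
  rw [Set.mem_sdiff, not_and_or, not_not, mem_ball_iff_norm, mem_closedBall_iff_norm, not_le] at h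
  rcases h with hfar | hnear
  · refine deriv_cutoff_of_gt ?_
    rw [lt_div_iff₀ (by positivity)]
    nlinarith
  · refine deriv_cutoff_of_lt ?_
    rw [div_lt_one (by positivity)]
    gcongr

variable [InnerProductSpace ℝ E]

theorem contDiff_radialCutoff : ContDiff ℝ 1 (radialCutoff c R) :=
  (contDiff_cutoff (n := 1)).comp
    (((contDiff_id.sub contDiff_const).norm_sq ℝ).div_const _)

variable [CompleteSpace E]

theorem gradient_radialCutoff :
    ∇ (radialCutoff c R) y = (2 / R ^ 2 * deriv cutoff (‖y - c‖ ^ 2 / R ^ 2)) • (y - c) := by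
  have hsq := ((hasFDerivAt_id y).sub_const c).norm_sq.mul_const (R ^ 2)⁻¹
  have hcomp := (hasDerivAt_cutoff (‖y - c‖ ^ 2 / R ^ 2)).hasFDerivAt.comp y hsq
  refine HasGradientAt.gradient (hasGradientAt_iff_hasFDerivAt.2 (hcomp.congr_fderiv ?_))
  ext v
  simp only [ContinuousLinearMap.comp_apply, smul_apply, ContinuousLinearMap.id_apply, id,
    ContinuousLinearMap.toSpanSingleton_apply, innerSL_apply_apply, smul_eq_mul, nsmul_eq_mul,
    InnerProductSpace.toDual_apply_apply, real_inner_smul_left]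
  push_cast
  ring

theorem gradient_radialCutoff_eq_zero (hR : 0 < R)
    (h : y ∉ Metric.closedBall c (2 * R) \ Metric.ball c R) : ∇ (radialCutoff c R) y = 0 := by
  rw [gradient_radialCutoff, deriv_cutoff_radial_eq_zero hR h, mul_zero, zero_smul]

theorem continuous_gradient_radialCutoff : Continuous (∇ (radialCutoff c R)) :=
  (InnerProductSpace.toDual ℝ E).symm.continuous.comp
    (contDiff_radialCutoff.continuous_fderiv one_ne_zero)

theorem gradient_radialCutoff_sub {c' : E} {R' : ℝ} :
    ∇ (fun y => radialCutoff c R y - radialCutoff c' R' y) y =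
      ∇ (radialCutoff c R) y - ∇ (radialCutoff c' R') y := by
  rw [gradient, fderiv_fun_sub (contDiff_radialCutoff.differentiable one_ne_zero y)
    (contDiff_radialCutoff.differentiable one_ne_zero y), map_sub]
  rfl

end RadialCutoff

section NearPole

/-- The mollifier which the flux of the fundamental solution through a radial cutoff produces. -/
def poleKernel (t : E3) : ℝ := -deriv cutoff (‖t‖ ^ 2) / (2 * Real.pi * ‖t‖)

theorem poleKernel_nonneg (t : E3) : 0 ≤ poleKernel t :=
  div_nonneg (neg_nonneg.2 (deriv_cutoff_nonpos _)) (by positivity)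

theorem poleKernel_eq_zero {t : E3} (ht : 2 ≤ ‖t‖) : poleKernel t = 0 := by
  rw [poleKernel, deriv_cutoff_of_gt (by nlinarith), neg_zero, zero_div]

theorem integral_poleKernel : ∫ t, poleKernel t = 1 := by
  have hpolar := integral_fun_norm_addHaar (volume : Measure E3)
    fun r : ℝ => -deriv cutoff (r ^ 2) / (2 * Real.pi * r)
  have hradial : ∫ r in Ioi (0 : ℝ),
      r ^ (Module.finrank ℝ E3 - 1) • (-deriv cutoff (r ^ 2) / (2 * Real.pi * r)) =
      ∫ r in Ioi (0 : ℝ), -(2 * Real.pi)⁻¹ * (r * deriv cutoff (r ^ 2)) := by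
    refine setIntegral_congr_fun measurableSet_Ioi fun r hr => ?_
    have hr0 : r ≠ 0 := (mem_Ioi.1 hr).ne'
    simp only [finrank_euclideanSpace, Fintype.card_fin, smul_eq_mul]
    field_simp
  rw [hradial, integral_const_mul, integral_mul_deriv_cutoff_sq, Measure.real,
    EuclideanSpace.volume_ball_fin_three] at hpolar
  simp only [poleKernel, hpolar, finrank_euclideanSpace, Fintype.card_fin, ENNReal.ofReal_one,
    one_pow, one_mul, smul_eq_mul, nsmul_eq_mul]
  rw [ENNReal.toReal_ofReal (by positivity)]
  push_cast
  field_simp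
  norm_num

/-- The function whose value at the pole `x` of the fundamental solution is the limit of the flux
through small spheres. -/
def poleDensity (κ : ℝ) (x : E3) (u : E3 → ℂ) (y : E3) : ℂ :=
  Complex.exp (Complex.I * (κ * ‖x - y‖ : ℝ)) *
    ((1 - Complex.I * κ * ‖x - y‖) * u y + fderiv ℝ u y (y - x))

theorem poleDensity_self (κ : ℝ) (x : E3) (u : E3 → ℂ) : poleDensity κ x u x = u x := by
  simp [poleDensity]

theorem IsHelmholtzOn.continuousOn_poleDensity {κ : ℝ} {V : Set E3} {u : E3 → ℂ}
    (hu : IsHelmholtzOn κ V u) (x : E3) : ContinuousOn (poleDensity κ x u) V := by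
  have hexp : Continuous fun y => Complex.exp (Complex.I * (κ * ‖x - y‖ : ℝ)) := by fun_prop
  have hfactor : Continuous fun y => 1 - Complex.I * κ * ‖x - y‖ := by fun_prop
  exact hexp.continuousOn.mul ((hfactor.continuousOn.mul hu.continuousOn).add
    (hu.continuousOn_fderiv.clm_apply (by fun_prop)))

theorem flux_greenFun_gradient_radialCutoff (κ : ℝ) (x : E3) (u : E3 → ℂ) {c : ℝ} (hc : 0 < c)
    (y : E3) : flux u (greenFun κ x) y (∇ (radialCutoff x c⁻¹) y) =
      (c ^ Module.finrank ℝ E3 * poleKernel (c • (x - y))) • poleDensity κ x u y := by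
  rcases eq_or_ne y x with rfl | hy
  · simp [gradient_radialCutoff, poleKernel]
  have hnorm : (‖x - y‖ : ℂ) ≠ 0 := by
    exact_mod_cast norm_ne_zero_iff.2 (sub_ne_zero.2 hy.symm)
  have hcc : (c : ℂ) ≠ 0 := by exact_mod_cast hc.ne'
  have hpi : (Real.pi : ℂ) ≠ 0 := by exact_mod_cast Real.pi_ne_zero
  have hscale : ‖x - y‖ ^ 2 / c⁻¹ ^ 2 = (c * ‖x - y‖) ^ 2 := by field_simp
  rw [gradient_radialCutoff, map_smul, flux_apply, (hasFDerivAt_greenFun κ hy).fderiv,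
    ContinuousLinearMap.smulRight_apply, innerSL_apply_apply, real_inner_self_eq_norm_sq,
    norm_sub_rev y x, hscale, poleKernel, norm_smul, Real.norm_of_nonneg hc.le]
  simp only [greenFun, greenSlope, poleDensity, Complex.real_smul, finrank_euclideanSpace,
    Fintype.card_fin]
  push_cast
  field_simp
  ring

theorem IsHelmholtzOn.tendsto_flux_near_pole {κ : ℝ} {V : Set E3} {u : E3 → ℂ}
    (hu : IsHelmholtzOn κ V u) {x : E3} (hx : x ∈ V) :
    Tendsto (fun ε : ℝ => ∫ y, flux u (greenFun κ x) y (∇ (radialCutoff x ε) y)) (𝓝[>] 0)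
      (𝓝 (u x)) := by
  obtain ⟨δ, hδ, hball⟩ := Metric.nhds_basis_closedBall.mem_iff.1 (hu.isOpen.mem_nhds hx)
  set g := (Metric.closedBall x δ).indicator (poleDensity κ x u) with hg
  have hgx : g x = u x := by
    rw [hg, indicator_of_mem (Metric.mem_closedBall_self hδ.le), poleDensity_self]
  have hgint : Integrable g := (((hu.continuousOn_poleDensity x).mono hball).integrableOn_compact
    (isCompact_closedBall x δ)).integrable_indicator Metric.isClosed_closedBall.measurableSet
  have hgcont : ContinuousAt g x :=
    ((hu.continuousOn_poleDensity x).continuousAt (hu.isOpen.mem_nhds hx)).congr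
      (mem_of_superset (Metric.closedBall_mem_nhds x hδ) fun y hy => (indicator_of_mem hy _).symm)
  have hdecay : Tendsto (fun t => ‖t‖ ^ Module.finrank ℝ E3 * poleKernel t)
      (Bornology.cobounded E3) (𝓝 0) :=
    tendsto_const_nhds.congr' ((eventually_cobounded_le_norm 2).mono fun t ht => by
      simp only [poleKernel_eq_zero ht, mul_zero])
  have hpeak := (tendsto_integral_comp_smul_smul_of_integrable' poleKernel_nonneg
    integral_poleKernel hdecay hgint hgcont).comp tendsto_inv_nhdsGT_zero
  rw [hgx] at hpeak
  refine hpeak.congr' ?_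
  filter_upwards [Ioo_mem_nhdsGT (half_pos hδ)] with ε ⟨hε, hεδ⟩
  refine integral_congr_ae (ae_of_all _ fun y => ?_)
  have hflux := flux_greenFun_gradient_radialCutoff κ x u (inv_pos.2 hε) y
  rw [inv_inv] at hflux
  change (ε⁻¹ ^ Module.finrank ℝ E3 * poleKernel (ε⁻¹ • (x - y))) • g y =
    flux u (greenFun κ x) y (∇ (radialCutoff x ε) y)
  rw [hflux]
  by_cases hy : y ∈ Metric.closedBall x δ
  · rw [hg, indicator_of_mem hy]
  · have hfar : 2 ≤ ‖ε⁻¹ • (x - y)‖ := by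
      rw [mem_closedBall_iff_norm, not_le, norm_sub_rev] at hy
      rw [norm_smul, norm_inv, Real.norm_of_nonneg hε.le, inv_mul_eq_div, le_div_iff₀ hε]
      linarith
    simp only [poleKernel_eq_zero hfar, mul_zero, zero_smul]

end NearPole

section ShellWeight

variable {E : Type*} [NormedAddCommGroup E] {R : ℝ} {y : E}

/-- The length of the gradient of the radial cutoff function around the origin at scale `R`.
Integrals against this weight on a shell play the role of integrals over the sphere of radius
`R`. -/
def shellWeight (R : ℝ) (y : E) : ℝ := -(2 / R ^ 2 * deriv cutoff (‖y‖ ^ 2 / R ^ 2) * ‖y‖)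

theorem shellWeight_nonneg (R : ℝ) (y : E) : 0 ≤ shellWeight R y :=
  neg_nonneg.2 <| mul_nonpos_of_nonpos_of_nonneg
    (mul_nonpos_of_nonneg_of_nonpos (by positivity) (deriv_cutoff_nonpos _)) (norm_nonneg y)

theorem continuous_shellWeight (R : ℝ) : Continuous (shellWeight R : E → ℝ) :=
  ((continuous_const.mul (continuous_deriv_cutoff.comp (by fun_prop))).mul continuous_norm).neg

theorem shellWeight_eq_zero (hR : 0 < R)
    (hy : y ∉ Metric.closedBall 0 (2 * R) \ Metric.ball 0 R) : shellWeight R y = 0 := by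
  have hderiv := deriv_cutoff_radial_eq_zero hR hy
  rw [sub_zero] at hderiv
  rw [shellWeight, hderiv, mul_zero, zero_mul, neg_zero]

theorem shellWeight_eq_zero_of_norm_lt (hR : 0 < R) (hy : ‖y‖ < R) : shellWeight R y = 0 :=
  shellWeight_eq_zero hR fun h => h.2 (mem_ball_zero_iff.2 hy)

theorem isCompact_annulus [ProperSpace E] (c : E) (R : ℝ) :
    IsCompact (Metric.closedBall c (2 * R) \ Metric.ball c R) :=
  (isCompact_closedBall c _).diff Metric.isOpen_ball

theorem integrable_of_continuousOn_of_eq_zero {F : Type*} [NormedAddCommGroup F]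
    [MeasurableSpace E] [BorelSpace E] {μ : Measure E} [IsFiniteMeasureOnCompacts μ] {s : Set E}
    {f : E → F} (hf : ContinuousOn f s) (hs : IsCompact s) (h : ∀ y ∉ s, f y = 0) :
    Integrable f μ :=
  (integrableOn_iff_integrable_of_support_subset (Function.support_subset_iff'.2 h)).1
    (hf.integrableOn_compact hs)

theorem integrable_shellWeight [ProperSpace E] [MeasurableSpace E] [BorelSpace E] {μ : Measure E}
    [IsFiniteMeasureOnCompacts μ] (hR : 0 < R) : Integrable (shellWeight R) μ :=
  integrable_of_continuousOn_of_eq_zero (continuous_shellWeight R).continuousOn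
    (isCompact_annulus 0 R) fun _ => shellWeight_eq_zero hR

variable [InnerProductSpace ℝ E]

theorem integral_shellWeight [FiniteDimensional ℝ E] [MeasurableSpace E] [BorelSpace E]
    {μ : Measure E} [μ.IsAddHaarMeasure] (hR : 0 < R) :
    ∫ y : E, shellWeight R y ∂μ =
      R⁻¹ * R ^ Module.finrank ℝ E * ∫ y : E, shellWeight 1 y ∂μ := by
  have hscale (y : E) : shellWeight R y = R⁻¹ * shellWeight 1 (R⁻¹ • y) := by
    rw [shellWeight, shellWeight, norm_smul, norm_inv, Real.norm_of_nonneg hR.le]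
    field_simp
  simp only [hscale]
  rw [integral_const_mul, Measure.integral_comp_inv_smul_of_nonneg μ _ hR.le, smul_eq_mul,
    mul_assoc]

theorem gradient_radialCutoff_zero [CompleteSpace E] :
    ∇ (radialCutoff 0 R) y = -shellWeight R y • (‖y‖⁻¹ • y) := by
  rw [gradient_radialCutoff, sub_zero, shellWeight, neg_neg, smul_smul]
  rcases eq_or_ne y 0 with rfl | hy
  · simp only [smul_zero]
  · rw [mul_inv_cancel_right₀ (norm_ne_zero_iff.2 hy)]

end ShellWeight

section FluxThroughSpheres

variable {E : Type*} [NormedAddCommGroup E] [InnerProductSpace ℝ E]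

/-- The expression `∂u/∂r - iκu` in Sommerfeld's radiation condition. -/
def radiationDefect (κ : ℝ) (u : E → ℂ) (y : E) : ℂ :=
  fderiv ℝ u y (‖y‖⁻¹ • y) - Complex.I * κ * u y

theorem flux_radial (κ : ℝ) (u w : E → ℂ) (y : E) :
    flux u w y (‖y‖⁻¹ • y) = u y * radiationDefect κ w y - w y * radiationDefect κ u y := by
  rw [flux_apply, radiationDefect, radiationDefect]
  ring

theorem flux_gradient_radialCutoff_zero [CompleteSpace E] (u w : E → ℂ) (R : ℝ) (y : E) :
    flux u w y (∇ (radialCutoff 0 R) y) = -(shellWeight R y * flux u w y (‖y‖⁻¹ • y)) := by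
  rw [gradient_radialCutoff_zero, map_smul, Complex.real_smul, Complex.ofReal_neg, neg_mul]

theorem fderiv_conj_apply (u : E → ℂ) (y v : E) :
    fderiv ℝ (fun y => conj (u y)) y v = conj (fderiv ℝ u y v) :=
  congrArg (fun A : E →L[ℝ] ℂ => A v) (Complex.conjCLE.comp_fderiv (f := u) (x := y))

theorem mul_norm_sq_le_neg_im_flux {κ : ℝ} (hκ : 0 < κ) (u : E → ℂ) (y : E) :
    κ * ‖u y‖ ^ 2 ≤
      -(flux u (fun y => conj (u y)) y (‖y‖⁻¹ • y)).im + ‖radiationDefect κ u y‖ ^ 2 / κ := by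
  set h := radiationDefect κ u y with hdef
  have hfderiv : fderiv ℝ u y (‖y‖⁻¹ • y) = h + Complex.I * κ * u y := by
    rw [hdef, radiationDefect, sub_add_cancel]
  have him : -(flux u (fun y => conj (u y)) y (‖y‖⁻¹ • y)).im =
      2 * (κ * ‖u y‖ ^ 2 + (conj (u y) * h).im) := by
    rw [flux_apply, fderiv_conj_apply, hfderiv, ← Complex.normSq_eq_norm_sq, Complex.normSq_apply]
    simp only [map_add, map_mul, Complex.conj_I, Complex.conj_ofReal, Complex.sub_im,
      Complex.add_im, Complex.add_re, Complex.mul_im, Complex.mul_re, Complex.neg_im,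
      Complex.neg_re, Complex.conj_im, Complex.conj_re, Complex.I_re, Complex.I_im,
      Complex.ofReal_re, Complex.ofReal_im]
    ring
  have hcross : -(‖u y‖ * ‖h‖) ≤ (conj (u y) * h).im := by
    have habs := Complex.abs_im_le_norm (conj (u y) * h)
    rw [norm_mul, RCLike.norm_conj] at habs
    exact neg_le_of_abs_le habs
  have hsq : κ * ‖u y‖ ^ 2 + ‖h‖ ^ 2 / κ - 2 * (‖u y‖ * ‖h‖) = (κ * ‖u y‖ - ‖h‖) ^ 2 / κ := by
    field_simp
    ring
  have hsq_nonneg : 0 ≤ (κ * ‖u y‖ - ‖h‖) ^ 2 / κ := by positivity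
  linarith

variable [FiniteDimensional ℝ E] [MeasurableSpace E] [BorelSpace E] {κ : ℝ} {U : Set E}
  {u w : E → ℂ} {μ : Measure E}

namespace IsHelmholtzOn

theorem integrable_flux_gradient_radialCutoff [IsFiniteMeasureOnCompacts μ]
    (hu : IsHelmholtzOn κ U u) (hw : IsHelmholtzOn κ U w) {c : E} {R : ℝ} (hR : 0 < R)
    (hU : Metric.closedBall c (2 * R) \ Metric.ball c R ⊆ U) :
    Integrable (fun y => flux u w y (∇ (radialCutoff c R) y)) μ :=
  integrable_of_continuousOn_of_eq_zero
    (((hu.continuousOn_flux hw).mono hU).clm_apply continuous_gradient_radialCutoff.continuousOn)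
    (isCompact_annulus c R) fun y hy => by rw [gradient_radialCutoff_eq_zero hR hy, map_zero]

theorem integral_flux_gradient_radialCutoff_sub [IsFiniteMeasureOnCompacts μ]
    (hu : IsHelmholtzOn κ U u) (hw : IsHelmholtzOn κ U w) {c c' : E} {R R' : ℝ} (hR : 0 < R)
    (hR' : 0 < R') (hU : Metric.closedBall c (2 * R) \ Metric.ball c R ⊆ U)
    (hU' : Metric.closedBall c' (2 * R') \ Metric.ball c' R' ⊆ U) :
    ∫ y, flux u w y (∇ (fun y => radialCutoff c R y - radialCutoff c' R' y) y) ∂μ =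
      (∫ y, flux u w y (∇ (radialCutoff c R) y) ∂μ) -
        ∫ y, flux u w y (∇ (radialCutoff c' R') y) ∂μ := by
  simp only [gradient_radialCutoff_sub, map_sub]
  exact integral_sub (hu.integrable_flux_gradient_radialCutoff hw hR hU)
    (hu.integrable_flux_gradient_radialCutoff hw hR' hU')

theorem integral_flux_gradient_radialCutoff_eq [μ.IsAddHaarMeasure]
    (hu : IsHelmholtzOn κ U u) (hw : IsHelmholtzOn κ U w) {R R' : ℝ} (hR : 0 < R) (hRR' : R ≤ R')
    (hU : ∀ y, R ≤ ‖y‖ → y ∈ U) :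
    ∫ y, flux u w y (∇ (radialCutoff 0 R') y) ∂μ =
      ∫ y, flux u w y (∇ (radialCutoff 0 R) y) ∂μ := by
  have hR' : 0 < R' := hR.trans_le hRR'
  have hannulus {r : ℝ} (hr : R ≤ r) : Metric.closedBall 0 (2 * r) \ Metric.ball 0 r ⊆ U :=
    fun y hy => hU y (hr.trans (not_lt.1 fun h => hy.2 (mem_ball_zero_iff.2 h)))
  have hsupport : tsupport (fun y : E => radialCutoff 0 R' y - radialCutoff 0 R y) ⊆ U := by
    refine (closure_minimal (fun y hy => ?_)
      (isClosed_le continuous_const continuous_norm : IsClosed {y : E | R ≤ ‖y‖})).trans hU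
    by_contra hlt
    rw [Set.mem_ofPred_eq, not_le] at hlt
    refine hy ?_
    beta_reduce
    rw [radialCutoff_eq_one hR' (by rw [sub_zero]; exact hlt.le.trans hRR'),
      radialCutoff_eq_one hR (by rw [sub_zero]; exact hlt.le), sub_self]
  rw [← sub_eq_zero, ← hu.integral_flux_gradient_radialCutoff_sub hw hR' hR (hannulus hRR')
    (hannulus le_rfl)]
  exact hu.integral_flux_gradient_eq_zero hw (contDiff_radialCutoff.sub contDiff_radialCutoff)
    ((hasCompactSupport_radialCutoff hR').sub (hasCompactSupport_radialCutoff hR)) hsupport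

theorem integrable_shellWeight_mul_norm_sq [IsFiniteMeasureOnCompacts μ]
    (hu : IsHelmholtzOn κ U u) {R : ℝ} (hR : 0 < R) (hU : ∀ y, R ≤ ‖y‖ → y ∈ U) :
    Integrable (fun y => shellWeight R y * ‖u y‖ ^ 2) μ :=
  integrable_of_continuousOn_of_eq_zero
    ((continuous_shellWeight R).continuousOn.mul ((hu.continuousOn.mono fun y hy =>
      hU y (not_lt.1 fun h => hy.2 (mem_ball_zero_iff.2 h))).norm.pow 2))
    (isCompact_annulus 0 R) fun _ hy => by rw [shellWeight_eq_zero hR hy, zero_mul]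

end IsHelmholtzOn

end FluxThroughSpheres

section Radiation

/-- Sommerfeld's radiation condition in `ℝ³`, uniform in all directions. -/
def IsRadiating (κ : ℝ) (u : E3 → ℂ) : Prop :=
  Tendsto (fun y : E3 => (‖y‖ : ℂ) * radiationDefect κ u y) (Bornology.cobounded E3) (𝓝 0)

variable {κ : ℝ} {U : Set E3} {u : E3 → ℂ}

theorem IsRadiating.eventually_norm_radiationDefect_le (hrad : IsRadiating κ u) {δ : ℝ}
    (hδ : 0 < δ) : ∀ᶠ R in atTop, ∀ y : E3, R ≤ ‖y‖ → ‖radiationDefect κ u y‖ ≤ δ / R := by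
  obtain ⟨R₁, -, hR₁⟩ := hasBasis_cobounded_norm.eventually_iff.1
    (Metric.tendsto_nhds.1 hrad δ hδ)
  filter_upwards [eventually_ge_atTop R₁, eventually_gt_atTop 0] with R hR hR0 y hy
  have hdist := hR₁ (hR.trans hy)
  rw [dist_zero_right, norm_mul, Complex.norm_real, norm_norm] at hdist
  rw [le_div_iff₀ hR0, mul_comm]
  exact (mul_le_mul_of_nonneg_right hy (norm_nonneg _)).trans hdist.le

theorem eventually_forall_le_norm_mem (hU : U ∈ Bornology.cobounded E3) :
    ∀ᶠ R in atTop, ∀ y : E3, R ≤ ‖y‖ → y ∈ U := by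
  obtain ⟨R₁, -, hR₁⟩ := hasBasis_cobounded_norm.mem_iff.1 hU
  filter_upwards [eventually_ge_atTop R₁] with R hR y hy using hR₁ (hR.trans hy)

theorem mul_shellWeight_mul_norm_sq_le (hκ : 0 < κ) {R : ℝ} (hR : 0 < R)
    (hdefect : ∀ y, R ≤ ‖y‖ → ‖radiationDefect κ u y‖ ≤ 1 / R) (y : E3) :
    κ * (shellWeight R y * ‖u y‖ ^ 2) ≤
      (flux u (fun y => conj (u y)) y (∇ (radialCutoff 0 R) y)).im +
        (1 / R) ^ 2 / κ * shellWeight R y := by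
  rw [flux_gradient_radialCutoff_zero, Complex.neg_im, Complex.im_ofReal_mul]
  rcases lt_or_ge ‖y‖ R with hy | hy
  · simp [shellWeight_eq_zero_of_norm_lt hR hy]
  · calc κ * (shellWeight R y * ‖u y‖ ^ 2) = shellWeight R y * (κ * ‖u y‖ ^ 2) := by ring
      _ ≤ shellWeight R y * (-(flux u (fun y => conj (u y)) y (‖y‖⁻¹ • y)).im +
            (1 / R) ^ 2 / κ) := by
          refine mul_le_mul_of_nonneg_left ?_ (shellWeight_nonneg R y)
          refine (mul_norm_sq_le_neg_im_flux hκ u y).trans ?_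
          gcongr
          exact hdefect y hy
      _ = _ := by ring

theorem mul_integral_shellWeight_mul_norm_sq_le (hκ : 0 < κ) (hu : IsHelmholtzOn κ U u) {R : ℝ}
    (hR : 0 < R) (hU : ∀ y, R ≤ ‖y‖ → y ∈ U)
    (hdefect : ∀ y, R ≤ ‖y‖ → ‖radiationDefect κ u y‖ ≤ 1 / R) :
    κ * ∫ y, shellWeight R y * ‖u y‖ ^ 2 ≤
      ‖∫ y, flux u (fun y => conj (u y)) y (∇ (radialCutoff 0 R) y)‖ +
        (∫ y : E3, shellWeight 1 y) / κ := by
  have hflux := hu.integrable_flux_gradient_radialCutoff (μ := volume) hu.conjugate hR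
    fun y hy => hU y (not_lt.1 fun h => hy.2 (mem_ball_zero_iff.2 h))
  have him : Integrable fun y =>
      (flux u (fun y => conj (u y)) y (∇ (radialCutoff 0 R) y)).im := hflux.im
  have hweight : Integrable (shellWeight R : E3 → ℝ) := integrable_shellWeight hR
  calc κ * ∫ y, shellWeight R y * ‖u y‖ ^ 2 = ∫ y, κ * (shellWeight R y * ‖u y‖ ^ 2) :=
        (integral_const_mul _ _).symm
    _ ≤ ∫ y, ((flux u (fun y => conj (u y)) y (∇ (radialCutoff 0 R) y)).im +
          (1 / R) ^ 2 / κ * shellWeight R y) :=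
        integral_mono ((hu.integrable_shellWeight_mul_norm_sq hR hU).const_mul κ)
          (him.add (hweight.const_mul _)) (mul_shellWeight_mul_norm_sq_le hκ hR hdefect)
    _ = (∫ y, flux u (fun y => conj (u y)) y (∇ (radialCutoff 0 R) y)).im +
          (1 / R) ^ 2 / κ * ∫ y : E3, shellWeight R y := by
        rw [integral_add him (hweight.const_mul _), integral_const_mul]
        exact congrArg (· + _) (integral_im hflux)
    _ ≤ _ := by
        rw [integral_shellWeight hR, finrank_euclideanSpace_fin]
        refine add_le_add ((le_abs_self _).trans (Complex.abs_im_le_norm _)) (le_of_eq ?_)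
        field_simp

/-- The flux of `u ∇ū - ū ∇u` through spheres does not depend on the radius, and by the radiation
condition its imaginary part is comparable to the mean square of `u`. -/
theorem IsRadiating.exists_integral_shellWeight_mul_norm_sq_le (hrad : IsRadiating κ u)
    (hκ : 0 < κ) (hu : IsHelmholtzOn κ U u) (hU : U ∈ Bornology.cobounded E3) :
    ∃ C : ℝ, ∀ᶠ R in atTop, ∫ y, shellWeight R y * ‖u y‖ ^ 2 ≤ C := by
  obtain ⟨R₀, hUR₀, hR₀⟩ :=
    ((eventually_forall_le_norm_mem hU).and (eventually_gt_atTop 0)).exists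
  refine ⟨(‖∫ y, flux u (fun y => conj (u y)) y (∇ (radialCutoff 0 R₀) y)‖ +
    (∫ y : E3, shellWeight 1 y) / κ) / κ, ?_⟩
  filter_upwards [hrad.eventually_norm_radiationDefect_le one_pos, eventually_ge_atTop R₀]
    with R hdefect hR
  rw [le_div_iff₀' hκ, ← hu.integral_flux_gradient_radialCutoff_eq hu.conjugate hR₀ hR hUR₀]
  exact mul_integral_shellWeight_mul_norm_sq_le hκ hu (hR₀.trans_le hR)
    (fun y hy => hUR₀ y (hR.trans hy)) hdefect

end Radiation

section FarField

theorem norm_greenFun (κ : ℝ) (x y : E3) : ‖greenFun κ x y‖ = 1 / (4 * Real.pi * ‖x - y‖) := by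
  rw [greenFun, norm_div, mul_comm Complex.I, Complex.norm_exp_ofReal_mul_I, Complex.norm_real,
    Real.norm_of_nonneg (by positivity)]

theorem half_le_norm_sub {E : Type*} [SeminormedAddCommGroup E] {x y : E} {R : ℝ}
    (hx : 2 * ‖x‖ ≤ R) (hy : R ≤ ‖y‖) : R / 2 ≤ ‖x - y‖ := by
  have hsub := norm_sub_norm_le y x
  rw [norm_sub_rev] at hsub
  linarith

theorem norm_greenFun_le (κ : ℝ) {x y : E3} {r : ℝ} (hr : 0 < r) (hxy : r ≤ ‖x - y‖) :
    ‖greenFun κ x y‖ ≤ 1 / r := by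
  rw [norm_greenFun]
  gcongr
  nlinarith [Real.pi_gt_three]

theorem abs_inner_radial_div_sub_one_le {E : Type*} [NormedAddCommGroup E]
    [InnerProductSpace ℝ E] {x y : E} (hxy : x ≠ y) (hy : y ≠ 0) :
    |⟪y - x, ‖y‖⁻¹ • y⟫_ℝ / ‖x - y‖ - 1| ≤ 2 * ‖x‖ / ‖x - y‖ := by
  have hy' : ‖y‖ ≠ 0 := norm_ne_zero_iff.2 hy
  have hpos : 0 < ‖x - y‖ := norm_pos_iff.2 (sub_ne_zero.2 hxy)
  have hinner : |⟪x, ‖y‖⁻¹ • y⟫_ℝ| ≤ ‖x‖ := by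
    refine (abs_real_inner_le_norm _ _).trans_eq ?_
    rw [norm_smul, norm_inv, norm_norm, inv_mul_cancel₀ hy', mul_one]
  have hnorm : |‖y‖ - ‖x - y‖| ≤ ‖x‖ := by
    have hrev := abs_norm_sub_norm_le y (y - x)
    rwa [sub_sub_cancel, norm_sub_rev y x] at hrev
  have hradial : ⟪y, ‖y‖⁻¹ • y⟫_ℝ = ‖y‖ := by
    rw [real_inner_smul_right, real_inner_self_eq_norm_sq]
    field_simp
  rw [div_sub_one hpos.ne', abs_div, abs_of_pos hpos, inner_sub_left, hradial]
  gcongr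
  rw [sub_right_comm]
  refine (abs_sub _ _).trans ?_
  linarith

theorem radiationDefect_greenFun (κ : ℝ) {x y : E3} (hxy : x ≠ y) :
    radiationDefect κ (greenFun κ x) y = greenFun κ x y *
      (Complex.I * κ * (⟪y - x, ‖y‖⁻¹ • y⟫_ℝ / ‖x - y‖ - 1 : ℝ) -
        (⟪y - x, ‖y‖⁻¹ • y⟫_ℝ / ‖x - y‖ / ‖x - y‖ : ℝ)) := by
  have hnorm : (‖x - y‖ : ℂ) ≠ 0 := by exact_mod_cast norm_ne_zero_iff.2 (sub_ne_zero.2 hxy)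
  have hpi : (Real.pi : ℂ) ≠ 0 := by exact_mod_cast Real.pi_ne_zero
  rw [radiationDefect, (hasFDerivAt_greenFun κ hxy.symm).fderiv,
    ContinuousLinearMap.smulRight_apply, innerSL_apply_apply, greenSlope, greenFun,
    Complex.real_smul]
  push_cast
  field_simp
  ring

theorem norm_radiationDefect_greenFun_le (κ : ℝ) {x y : E3} {r : ℝ} (hr : 0 < r)
    (hxy : r ≤ ‖x - y‖) (hy : y ≠ 0) :
    ‖radiationDefect κ (greenFun κ x) y‖ ≤ (2 * |κ| * ‖x‖ + 1) / r ^ 2 := by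
  have hne : x ≠ y := sub_ne_zero.1 (norm_pos_iff.1 (hr.trans_le hxy))
  have hcos : |⟪y - x, ‖y‖⁻¹ • y⟫_ℝ / ‖x - y‖| ≤ 1 := by
    rw [abs_div, abs_norm]
    refine div_le_one_of_le₀ ((abs_real_inner_le_norm _ _).trans_eq ?_) (norm_nonneg _)
    rw [norm_smul, norm_inv, norm_norm, inv_mul_cancel₀ (norm_ne_zero_iff.2 hy), mul_one,
      norm_sub_rev]
  rw [radiationDefect_greenFun κ hne, norm_mul]
  calc _ ≤ 1 / r * (|κ| * (2 * ‖x‖ / r) + 1 / r) := by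
        refine mul_le_mul (norm_greenFun_le κ hr hxy) ((norm_sub_le _ _).trans ?_)
          (norm_nonneg _) (by positivity)
        rw [norm_mul, norm_mul, Complex.norm_I, one_mul, Complex.norm_real, Complex.norm_real,
          Complex.norm_real, Real.norm_eq_abs, Real.norm_eq_abs, Real.norm_eq_abs,
          abs_div _ ‖x - y‖, abs_norm]
        gcongr
        exact (abs_inner_radial_div_sub_one_le hne hy).trans (by gcongr)
    _ = _ := by field_simp

variable {κ : ℝ} {U : Set E3} {u : E3 → ℂ}

theorem norm_flux_greenFun_radial_le {x y : E3} {R δ : ℝ} (hR : 0 < R) (hx : 2 * ‖x‖ ≤ R)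
    (hy : R ≤ ‖y‖) (hdefect : ‖radiationDefect κ u y‖ ≤ δ / R) :
    ‖flux u (greenFun κ x) y (‖y‖⁻¹ • y)‖ ≤ 1 / R * ‖u y‖ ^ 2 +
      ((4 * (2 * |κ| * ‖x‖ + 1)) ^ 2 / R ^ 3 + 2 * δ / R ^ 2) := by
  set k := 4 * (2 * |κ| * ‖x‖ + 1) with hk
  have hxy := half_le_norm_sub hx hy
  have hgreen : ‖greenFun κ x y‖ ≤ 2 / R :=
    (norm_greenFun_le κ (half_pos hR) hxy).trans_eq (by field_simp)
  have hgreen_defect : ‖radiationDefect κ (greenFun κ x) y‖ ≤ k / R ^ 2 := by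
    refine (norm_radiationDefect_greenFun_le κ (half_pos hR) hxy
      (norm_pos_iff.1 (hR.trans_le hy))).trans_eq ?_
    rw [hk]
    field_simp
    norm_num
  have hsq : 1 / R * ‖u y‖ ^ 2 + k ^ 2 / R ^ 3 - ‖u y‖ * (k / R ^ 2) =
      1 / R * ((‖u y‖ - k / R / 2) ^ 2 + 3 / 4 * (k / R) ^ 2) := by
    field_simp
    ring
  have hsq_nonneg : 0 ≤ 1 / R * ((‖u y‖ - k / R / 2) ^ 2 + 3 / 4 * (k / R) ^ 2) := by positivity
  calc ‖flux u (greenFun κ x) y (‖y‖⁻¹ • y)‖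
      ≤ ‖u y‖ * (k / R ^ 2) + 2 / R * (δ / R) := by
        rw [flux_radial κ]
        refine (norm_sub_le _ _).trans ?_
        rw [norm_mul, norm_mul]
        gcongr
    _ ≤ 1 / R * ‖u y‖ ^ 2 + k ^ 2 / R ^ 3 + 2 / R * (δ / R) := by
        gcongr
        linarith
    _ = _ := by
        field_simp
        ring

theorem norm_integral_flux_greenFun_le (hu : IsHelmholtzOn κ U u) {x : E3} {R δ : ℝ}
    (hR : 0 < R) (hU : ∀ y, R ≤ ‖y‖ → y ∈ U) (hx : 2 * ‖x‖ ≤ R)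
    (hdefect : ∀ y, R ≤ ‖y‖ → ‖radiationDefect κ u y‖ ≤ δ / R) :
    ‖∫ y, flux u (greenFun κ x) y (∇ (radialCutoff 0 R) y)‖ ≤
      (∫ y, shellWeight R y * ‖u y‖ ^ 2) / R +
        ((4 * (2 * |κ| * ‖x‖ + 1)) ^ 2 / R + 2 * δ) * ∫ y : E3, shellWeight 1 y := by
  set k := 4 * (2 * |κ| * ‖x‖ + 1)
  have hsq := (hu.integrable_shellWeight_mul_norm_sq (μ := volume) hR hU).const_mul (1 / R)
  have hweight : Integrable fun y : E3 => (k ^ 2 / R ^ 3 + 2 * δ / R ^ 2) * shellWeight R y :=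
    (integrable_shellWeight hR).const_mul _
  have hpointwise (y : E3) : ‖flux u (greenFun κ x) y (∇ (radialCutoff 0 R) y)‖ ≤
      1 / R * (shellWeight R y * ‖u y‖ ^ 2) +
        (k ^ 2 / R ^ 3 + 2 * δ / R ^ 2) * shellWeight R y := by
    rw [flux_gradient_radialCutoff_zero, norm_neg, norm_mul, Complex.norm_real,
      Real.norm_of_nonneg (shellWeight_nonneg R y)]
    rcases lt_or_ge ‖y‖ R with hy | hy
    · simp [shellWeight_eq_zero_of_norm_lt hR hy]
    · refine (mul_le_mul_of_nonneg_left (norm_flux_greenFun_radial_le hR hx hy (hdefect y hy))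
        (shellWeight_nonneg R y)).trans_eq ?_
      ring
  refine (norm_integral_le_of_norm_le (hsq.add hweight) (ae_of_all _ hpointwise)).trans_eq ?_
  rw [integral_add' hsq hweight, integral_const_mul, integral_const_mul, integral_shellWeight hR,
    finrank_euclideanSpace_fin]
  field_simp

theorem IsRadiating.tendsto_flux_far (hrad : IsRadiating κ u) (hκ : 0 < κ)
    (hu : IsHelmholtzOn κ U u) (hU : U ∈ Bornology.cobounded E3) (x : E3) :
    Tendsto (fun R : ℝ => ∫ y, flux u (greenFun κ x) y (∇ (radialCutoff 0 R) y)) atTop (𝓝 0) := by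
  obtain ⟨C, hC⟩ := hrad.exists_integral_shellWeight_mul_norm_sq_le hκ hu hU
  set W := ∫ y : E3, shellWeight 1 y
  have hW : 0 ≤ W := integral_nonneg (shellWeight_nonneg 1)
  rw [Metric.tendsto_nhds]
  intro ε hε
  set δ := ε / (2 * (W + 1)) with hδdef
  have hδ : 0 < δ := by positivity
  have hδW : 2 * δ * W < ε := by
    rw [hδdef]
    field_simp
    linarith
  have hlim : Tendsto (fun R : ℝ => C / R + ((4 * (2 * |κ| * ‖x‖ + 1)) ^ 2 / R + 2 * δ) * W) atTop
      (𝓝 (0 + (0 + 2 * δ) * W)) :=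
    (tendsto_id.const_div_atTop C).add
      (((tendsto_id.const_div_atTop _).add_const _).mul_const W)
  rw [zero_add, zero_add] at hlim
  filter_upwards [hlim.eventually_lt_const hδW, hC, eventually_gt_atTop 0,
    eventually_forall_le_norm_mem hU, eventually_ge_atTop (2 * ‖x‖),
    hrad.eventually_norm_radiationDefect_le hδ] with R hsmall hCR hR hUR hx hdefect
  rw [dist_zero_right]
  refine ((norm_integral_flux_greenFun_le hu hR hUR hx hdefect).trans ?_).trans_lt hsmall
  gcongr

end FarField

section Representation

theorem exists_contDiff_eventuallyEq_zero_one {E : Type*} [NormedAddCommGroup E]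
    [NormedSpace ℝ E] [FiniteDimensional ℝ E] {K B : Set E} (n : ℕ∞) (hK : IsCompact K)
    (hB : IsOpen B) (hKB : K ⊆ B) :
    ∃ τ : E → ℝ, ContDiff ℝ n τ ∧ (∀ y ∈ K, τ =ᶠ[𝓝 y] 0) ∧ ∀ y ∉ B, τ =ᶠ[𝓝 y] 1 := by
  obtain ⟨K', hK', hKK', hK'B⟩ := exists_compact_between hK hB hKB
  obtain ⟨f, hf_one, hf_zero, -⟩ := exists_contMDiffMap_one_nhds_of_subset_interior
    (modelWithCornersSelf ℝ E) (n := n) hK.isClosed hKK'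
  refine ⟨fun y => 1 - f y, contDiff_const.sub (contMDiff_iff_contDiff.1 f.contMDiff),
    fun y hy => ?_, fun y hy => ?_⟩
  · filter_upwards [eventually_nhdsSet_iff_forall.1 hf_one y hy] with z hz
    rw [hz, sub_self, Pi.zero_apply]
  · filter_upwards [hK'.isClosed.isOpen_compl.mem_nhds fun hyK' => hy (hK'B hyK')] with z hz
    rw [hf_zero z hz, sub_zero, Pi.one_apply]

variable {κ : ℝ} {B K U : Set E3} {u w : E3 → ℂ}

/-- Multiplying `ψ` by a function that vanishes near `K` and equals one outside `B` allows `u` and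
`w` to be singular in `K`, without changing `ψ` outside `B`. -/
theorem IsLipschitzDomain.integral_flux_gradient (hB : IsLipschitzDomain B) (hK : IsCompact K)
    (hKB : K ⊆ B) (hu : IsHelmholtzOn κ U u) (hw : IsHelmholtzOn κ U w) {ψ : E3 → ℝ}
    (hψ : ContDiff ℝ 1 ψ) (hc : HasCompactSupport ψ) (hU : tsupport ψ \ K ⊆ U)
    (hψ_one : ∀ y ∈ closure B, ψ y = 1) :
    ∫ y, flux u w y (∇ ψ y) = -∫ z, flux u w z (outerNormal B z) ∂surfaceMeasure B := by
  obtain ⟨τ, hτ, hτ_zero, hτ_one⟩ := exists_contDiff_eventuallyEq_zero_one 1 hK hB.isOpen hKB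
  have hsupport : tsupport (fun y => τ y * ψ y) ⊆ U := by
    refine fun y hy => hU ⟨tsupport_mul_subset_right hy, fun hyK => ?_⟩
    refine notMem_tsupport_iff_eventuallyEq.2 ?_ hy
    filter_upwards [hτ_zero y hyK] with z hz
    rw [hz, Pi.zero_apply, zero_mul]
  have hfrontier : ∀ z ∈ frontier B, τ z * ψ z = 1 := fun z hz => by
    rw [(hτ_one z (disjoint_left.1 (disjoint_frontier_iff_isOpen.2 hB.isOpen) hz)).self_of_nhds,
      hψ_one z (frontier_subset_closure hz), Pi.one_apply, one_mul]
  have houtside : ∀ y ∈ Bᶜ, flux u w y (∇ ψ y) = flux u w y (∇ (fun y => τ y * ψ y) y) := by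
    intro y hy
    have heq : ψ =ᶠ[𝓝 y] fun y => τ y * ψ y := by
      filter_upwards [hτ_one y hy] with z hz
      rw [hz, Pi.one_apply, one_mul]
    rw [gradient, gradient, heq.fderiv_eq]
  have hinside : ∀ y ∉ Bᶜ, flux u w y (∇ ψ y) = 0 := by
    intro y hy
    have heq : ψ =ᶠ[𝓝 y] fun _ => 1 := by
      filter_upwards [hB.isOpen.mem_nhds (not_not.1 hy)] with z hz using
        hψ_one z (subset_closure hz)
    rw [gradient, heq.fderiv_eq, fderiv_const_apply, map_zero, map_zero]
  rw [← setIntegral_eq_integral_of_forall_compl_eq_zero hinside,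
    setIntegral_congr_fun hB.isOpen.measurableSet.compl houtside]
  exact hB.integral_compl_flux_gradient hu hw (hτ.mul hψ) hc.mul_left hsupport hfrontier

theorem notMem_tsupport_radialCutoff_sub {E : Type*} [NormedAddCommGroup E] {x : E} {ε R : ℝ}
    (hε : 0 < ε) (hx : x ∈ Metric.ball 0 R) :
    x ∉ tsupport fun y => radialCutoff 0 R y - radialCutoff x ε y := by
  refine notMem_tsupport_iff_eventuallyEq.2 ?_
  filter_upwards [Metric.isOpen_ball.mem_nhds hx, Metric.ball_mem_nhds x hε] with z hzR hzε
  rw [radialCutoff_eq_one (Metric.pos_of_mem_ball hx) (mem_ball_iff_norm.1 hzR).le,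
    radialCutoff_eq_one hε (mem_ball_iff_norm.1 hzε).le, sub_self, Pi.zero_apply]

theorem IsLipschitzDomain.integral_flux_radialCutoff_sub (hB : IsLipschitzDomain B)
    (hK : IsCompact K) (hKB : K ⊆ B) (hu : IsHelmholtzOn κ Kᶜ u) {x : E3} {ε R : ℝ} (hε : 0 < ε)
    (hball : Metric.closedBall x (2 * ε) ⊆ (closure B)ᶜ)
    (hR : insert x (closure B) ⊆ Metric.ball 0 R) :
    (∫ y, flux u (greenFun κ x) y (∇ (radialCutoff x ε) y)) -
        ∫ y, flux u (greenFun κ x) y (∇ (radialCutoff 0 R) y) =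
      ∫ z, (greenNormal κ B x z * u z - greenFun κ x z * normalDeriv B u z)
        ∂surfaceMeasure B := by
  have hxR : x ∈ Metric.ball 0 R := hR (mem_insert x _)
  have hR_pos : 0 < R := Metric.pos_of_mem_ball hxR
  have hKclosure : K ⊆ closure B := hKB.trans subset_closure
  have hopen : IsOpen (Kᶜ ∩ {x}ᶜ) := hu.isOpen.inter isOpen_compl_singleton
  have hu' : IsHelmholtzOn κ (Kᶜ ∩ {x}ᶜ) u := hu.mono hopen inter_subset_left
  have hgreen : IsHelmholtzOn κ (Kᶜ ∩ {x}ᶜ) (greenFun κ x) :=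
    (isHelmholtzOn_greenFun κ x).mono hopen inter_subset_right
  have hfar : Metric.closedBall 0 (2 * R) \ Metric.ball 0 R ⊆ Kᶜ ∩ {x}ᶜ := fun y hy =>
    ⟨fun hyK => hy.2 (hR (mem_insert_of_mem x (hKclosure hyK))), fun hyx => hy.2 (hyx ▸ hxR)⟩
  have hnear : Metric.closedBall x (2 * ε) \ Metric.ball x ε ⊆ Kᶜ ∩ {x}ᶜ := fun y hy =>
    ⟨fun hyK => hball hy.1 (hKclosure hyK), fun hyx => hy.2 (hyx ▸ Metric.mem_ball_self hε)⟩
  have hsupport : tsupport (fun y => radialCutoff 0 R y - radialCutoff x ε y) \ K ⊆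
      Kᶜ ∩ {x}ᶜ := by
    refine fun y hy => ⟨hy.2, ?_⟩
    rintro rfl
    exact notMem_tsupport_radialCutoff_sub hε hxR hy.1
  have hone : ∀ y ∈ closure B, radialCutoff 0 R y - radialCutoff x ε y = 1 := by
    intro y hy
    have hyx : 2 * ε ≤ ‖y - x‖ :=
      le_of_not_ge fun h => hball (mem_closedBall_iff_norm.2 h) hy
    rw [radialCutoff_eq_one hR_pos (mem_ball_iff_norm.1 (hR (mem_insert_of_mem x hy))).le,
      radialCutoff_eq_zero hε hyx, sub_zero]
  have hflux := hB.integral_flux_gradient hK hKB hu' hgreen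
    (contDiff_radialCutoff.sub contDiff_radialCutoff)
    ((hasCompactSupport_radialCutoff hR_pos).sub (hasCompactSupport_radialCutoff hε)) hsupport hone
  rw [hu'.integral_flux_gradient_radialCutoff_sub hgreen hR_pos hε hfar hnear] at hflux
  rw [← neg_sub, hflux, neg_neg]
  simp only [flux_apply, mul_comm (u _)]
  rfl

/-- Green's formula on the region between `B`, a small sphere around the pole `x` and a large
sphere: the flux through the former tends to `u x`, that through the latter to zero. -/
theorem IsLipschitzDomain.eq_integral_of_isRadiating (hB : IsLipschitzDomain B) (hκ : 0 < κ)
    (hK : IsCompact K) (hKB : K ⊆ B) (hu : IsHelmholtzOn κ Kᶜ u) (hrad : IsRadiating κ u) {x : E3}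
    (hx : x ∉ closure B) :
    u x = ∫ z, (greenNormal κ B x z * u z - greenFun κ x z * normalDeriv B u z)
      ∂surfaceMeasure B := by
  obtain ⟨δ, hδ, hδB⟩ := Metric.nhds_basis_closedBall.mem_iff.1
    (isClosed_closure.isOpen_compl.mem_nhds hx)
  obtain ⟨R₀, hR₀⟩ := (hB.isBounded.closure.insert x).subset_ball 0
  have hnear := hu.tendsto_flux_near_pole fun hxK => hx (subset_closure (hKB hxK))
  have hfar := hrad.tendsto_flux_far hκ hu hK.isBounded x
  have hlim := (hnear.comp tendsto_snd).sub (hfar.comp tendsto_fst)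
  rw [sub_zero] at hlim
  refine tendsto_nhds_unique hlim (tendsto_const_nhds.congr' ?_)
  filter_upwards [prod_mem_prod (Ici_mem_atTop R₀) (Ioo_mem_nhdsGT (half_pos hδ))] with p hp
  refine (hB.integral_flux_radialCutoff_sub hK hKB hu hp.2.1
    ((Metric.closedBall_subset_closedBall ?_).trans hδB)
    (hR₀.trans (Metric.ball_subset_ball hp.1))).symm
  linarith [hp.2.2]

end Representation

theorem IsHelmholtzOn.sub {E : Type*} [NormedAddCommGroup E] [InnerProductSpace ℝ E]
    [FiniteDimensional ℝ E] {κ : ℝ} {U : Set E} {u w : E → ℂ} (hu : IsHelmholtzOn κ U u)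
    (hw : IsHelmholtzOn κ U w) : IsHelmholtzOn κ U (u - w) := by
  refine ⟨hu.isOpen, hu.contDiffOn.sub hw.contDiffOn, fun y hy => ?_⟩
  rw [(hu.contDiffAt hy).laplacian_sub (hw.contDiffAt hy), hu.laplacian_eq y hy,
    hw.laplacian_eq y hy, Pi.sub_apply, mul_sub]

theorem IsScatteredWave.isHelmholtzOn {κ : ℝ} {d : E3} (hd : ‖d‖ = 1) {D : Set E3} {us : E3 → ℂ}
    (h : IsScatteredWave κ d D us) : IsHelmholtzOn κ (closure D)ᶜ us := by
  have htotal : IsHelmholtzOn κ (closure D)ᶜ (planeWave κ d + us) :=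
    ⟨isClosed_closure.isOpen_compl, h.contDiffOn, fun y hy => by
      rw [neg_mul]
      exact eq_neg_of_add_eq_zero_left (h.helmholtz y hy)⟩
  have hincident := (isHelmholtzOn_planeWave κ hd).mono htotal.isOpen (subset_univ _)
  simpa only [add_sub_cancel_left] using htotal.sub hincident

section Moments

variable {𝕜 Ω : Type*} [RCLike 𝕜] [MeasurableSpace Ω] {P : Measure Ω}

theorem integral_sub_mul_mul_conj_sub_mul {X₁ X₂ Y₁ Y₂ : Ω → 𝕜} (hX₁ : MemLp X₁ 2 P)
    (hX₂ : MemLp X₂ 2 P) (hY₁ : MemLp Y₁ 2 P) (hY₂ : MemLp Y₂ 2 P) (a b c e : 𝕜) :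
    ∫ ω, (a * X₁ ω - b * X₂ ω) * conj (c * Y₁ ω - e * Y₂ ω) ∂P =
      b * conj e * ∫ ω, X₂ ω * conj (Y₂ ω) ∂P - b * conj c * ∫ ω, X₂ ω * conj (Y₁ ω) ∂P -
          a * conj e * ∫ ω, X₁ ω * conj (Y₂ ω) ∂P +
        a * conj c * ∫ ω, X₁ ω * conj (Y₁ ω) ∂P := by
  have hint {X Y : Ω → 𝕜} (hX : MemLp X 2 P) (hY : MemLp Y 2 P) (k : 𝕜) :
      Integrable (fun ω => k * (X ω * conj (Y ω))) P := (hX.integrable_mul hY.star).const_mul k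
  have hexpand (ω : Ω) : (a * X₁ ω - b * X₂ ω) * conj (c * Y₁ ω - e * Y₂ ω) =
      b * conj e * (X₂ ω * conj (Y₂ ω)) - b * conj c * (X₂ ω * conj (Y₁ ω)) -
          a * conj e * (X₁ ω * conj (Y₂ ω)) +
        a * conj c * (X₁ ω * conj (Y₁ ω)) := by
    simp only [map_sub, map_mul]
    ring
  have hdiff := (hint hX₂ hY₂ (b * conj e)).sub (hint hX₂ hY₁ (b * conj c))
  have hdiff' := hdiff.sub (hint hX₁ hY₂ (a * conj e))
  simp only [hexpand]
  refine (integral_add hdiff' (hint hX₁ hY₁ (a * conj c))).trans ?_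
  rw [integral_sub' hdiff (hint hX₁ hY₂ _), integral_sub' (hint hX₂ hY₂ _) (hint hX₂ hY₁ _)]
  simp only [integral_const_mul]

theorem cov_eq_cor_sub [IsProbabilityMeasure P] {X : Ω → E3 → ℂ} {x x' : E3}
    (hx : MemLp (fun ω => X ω x) 2 P) (hx' : MemLp (fun ω => X ω x') 2 P) :
    cov P X x x' = cor P X X x x' - mean P X x * conj (mean P X x') := by
  have hexpand := integral_sub_mul_mul_conj_sub_mul hx (memLp_const 1) hx' (memLp_const 1) 1
    (mean P X x) 1 (mean P X x')
  simp only [one_mul, mul_one, map_one, integral_const, probReal_univ, one_smul, integral_conj]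
    at hexpand
  rw [cov, hexpand, cor, mean, mean]
  ring

theorem var_eq_cov (X : Ω → E3 → ℂ) (x : E3) : (var P X x : ℂ) = cov P X x x := by
  simp only [var, cov, Complex.mul_conj, Complex.normSq_eq_norm_sq]
  exact integral_complex_ofReal.symm

end Moments

section ProductFields

variable {𝕜 Ω S : Type*} [RCLike 𝕜] [MeasurableSpace Ω] [MeasurableSpace S] {P : Measure Ω}
  {σ : Measure S}

theorem ae_memLp_section [SFinite P] [SFinite σ] {E : Type*} [NormedAddCommGroup E]
    {X : Ω × S → E} {p : ℝ≥0∞} (hp : p ≠ 0) (hp' : p ≠ ∞) (hX : MemLp X p (P.prod σ)) :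
    ∀ᵐ z ∂σ, MemLp (fun ω => X (ω, z)) p P := by
  have hpow := ((integrable_norm_rpow_iff hX.aestronglyMeasurable hp hp').2 hX).prod_left_ae
  filter_upwards [hpow, hX.aestronglyMeasurable.prod_swap.prodMk_left] with z hz hmeas
  exact (integrable_norm_rpow_iff hmeas hp hp').1 hz

theorem integral_prod_mul_conj [SFinite σ] (f g : S → 𝕜) :
    ∫ q : S × S, f q.1 * conj (g q.2) ∂(σ.prod σ) = (∫ z, f z ∂σ) * conj (∫ z, g z ∂σ) := by
  rw [integral_prod_mul f fun z => conj (g z), integral_conj]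

variable [SFinite P] [IsFiniteMeasure σ] {X Y : Ω × S → 𝕜}

theorem integrable_prod_mul_conj (hX : MemLp X 2 (P.prod σ)) (hY : MemLp Y 2 (P.prod σ)) :
    Integrable (fun p : Ω × (S × S) => X (p.1, p.2.1) * conj (Y (p.1, p.2.2)))
      (P.prod (σ.prod σ)) := by
  have hfst {Z : Ω × S → 𝕜} (hZ : MemLp Z 2 (P.prod σ)) :
      MemLp (fun p : Ω × (S × S) => Z (p.1, p.2.1)) 2 (P.prod (σ.prod σ)) :=
    (hZ.comp_fst σ).comp_measurePreserving
      ((measurePreserving_prodAssoc P σ σ).symm MeasurableEquiv.prodAssoc)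
  have hsnd : MemLp (fun p : Ω × (S × S) => Y (p.1, p.2.2)) 2 (P.prod (σ.prod σ)) :=
    (hfst hY).comp_measurePreserving
      ((MeasurePreserving.id P).prod (Measure.measurePreserving_swap (μ := σ) (ν := σ)))
  exact (hfst hX).integrable_mul hsnd.star

theorem integral_integral_integral_mul_conj (hX : MemLp X 2 (P.prod σ))
    (hY : MemLp Y 2 (P.prod σ)) :
    ∫ z, ∫ z', ∫ ω, X (ω, z) * conj (Y (ω, z')) ∂P ∂σ ∂σ =
      ∫ ω, (∫ z, X (ω, z) ∂σ) * conj (∫ z, Y (ω, z) ∂σ) ∂P := by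
  have hXY := integrable_prod_mul_conj hX hY
  rw [← integral_prod (fun q : S × S => ∫ ω, X (ω, q.1) * conj (Y (ω, q.2)) ∂P)
    hXY.integral_prod_right, ← integral_integral_swap hXY]
  exact integral_congr_ae
    (ae_of_all _ fun ω => integral_prod_mul_conj (fun z => X (ω, z)) fun z => Y (ω, z))

theorem memLp_integral_section (hX : MemLp X 2 (P.prod σ)) :
    MemLp (fun ω => ∫ z, X (ω, z) ∂σ) 2 P := by
  refine (memLp_two_iff_integrable_sq_norm hX.aestronglyMeasurable.integral_prod_right').2
    ((integrable_prod_mul_conj hX hX).integral_prod_left.norm.congr (ae_of_all _ fun ω => ?_))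
  beta_reduce
  rw [integral_prod_mul_conj (fun z => X (ω, z)) fun z => X (ω, z), norm_mul, RCLike.norm_conj, sq]

end ProductFields

section Kernels

variable {B : Set E3} {x : E3}

theorem IsLipschitzDomain.memLp_top_of_continuousOn (hB : IsLipschitzDomain B) {F : Type*}
    [NormedAddCommGroup F] [SecondCountableTopologyEither E3 F] {f : E3 → F}
    (hf : ContinuousOn f (frontier B)) : MemLp f ∞ (surfaceMeasure B) := by
  obtain ⟨C, hC⟩ := hB.isCompact_frontier.exists_bound_of_continuousOn hf
  exact memLp_top_of_bound (hf.aestronglyMeasurable isClosed_frontier.measurableSet) C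
    ((ae_mem_frontier B).mono hC)

theorem frontier_subset_compl_singleton (hx : x ∉ closure B) : frontier B ⊆ {x}ᶜ :=
  subset_compl_singleton_iff.2 fun hmem => hx (frontier_subset_closure hmem)

theorem IsLipschitzDomain.memLp_top_greenFun (hB : IsLipschitzDomain B) (κ : ℝ)
    (hx : x ∉ closure B) : MemLp (greenFun κ x) ∞ (surfaceMeasure B) :=
  hB.memLp_top_of_continuousOn
    ((isHelmholtzOn_greenFun κ x).continuousOn.mono (frontier_subset_compl_singleton hx))

theorem IsLipschitzDomain.memLp_top_greenNormal (hB : IsLipschitzDomain B) (κ : ℝ)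
    (hx : x ∉ closure B) : MemLp (greenNormal κ B x) ∞ (surfaceMeasure B) :=
  (ContinuousLinearMap.id ℝ (E3 →L[ℝ] ℂ)).memLp_of_bilin ∞
    (hB.memLp_top_of_continuousOn
      ((isHelmholtzOn_greenFun κ x).continuousOn_fderiv.mono (frontier_subset_compl_singleton hx)))
    (memLp_top_of_bound hB.aestronglyMeasurable_outerNormal 1
      (ae_of_all _ (norm_outerNormal_le B)))

end Kernels

section WaveDensity

/-- The density of the boundary integral that represents the radiating wave `us ω` at `x` through
its Cauchy data on `∂B`, as a function on `Ω × ∂B`. -/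
def waveDensity {Ω : Type*} (κ : ℝ) (B : Set E3) (us : Ω → E3 → ℂ) (x : E3) (p : Ω × E3) : ℂ :=
  greenNormal κ B x p.2 * us p.1 p.2 - greenFun κ x p.2 * normalDeriv B (us p.1) p.2

variable {Ω : Type*} [MeasurableSpace Ω] {P : Measure Ω} {B : Set E3} {us : Ω → E3 → ℂ}

theorem IsLipschitzDomain.memLp_waveDensity [IsFiniteMeasure P] (hB : IsLipschitzDomain B)
    (κ : ℝ) (hdir : MemLp (fun p : Ω × E3 => us p.1 p.2) 2 (P.prod (surfaceMeasure B)))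
    (hneu : MemLp (fun p : Ω × E3 => normalDeriv B (us p.1) p.2) 2 (P.prod (surfaceMeasure B)))
    {x : E3} (hx : x ∉ closure B) :
    MemLp (waveDensity κ B us x) 2 (P.prod (surfaceMeasure B)) :=
  have := hB.isFiniteMeasure_surfaceMeasure
  (hdir.mul' ((hB.memLp_top_greenNormal κ hx).comp_snd P)).sub
    (hneu.mul' ((hB.memLp_top_greenFun κ hx).comp_snd P))

theorem ae_meanIntegrand_eq [IsFiniteMeasure P] [SFinite (surfaceMeasure B)]
    (hdir : MemLp (fun p : Ω × E3 => us p.1 p.2) 2 (P.prod (surfaceMeasure B)))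
    (hneu : MemLp (fun p : Ω × E3 => normalDeriv B (us p.1) p.2) 2 (P.prod (surfaceMeasure B)))
    (κ : ℝ) (x : E3) :
    ∀ᵐ z ∂surfaceMeasure B,
      ∫ ω, waveDensity κ B us x (ω, z) ∂P = meanIntegrand κ B P us x z := by
  filter_upwards [ae_memLp_section two_ne_zero ENNReal.ofNat_ne_top hdir,
    ae_memLp_section two_ne_zero ENNReal.ofNat_ne_top hneu] with z hdir_z hneu_z
  simp only [waveDensity]
  rw [integral_sub ((hdir_z.integrable one_le_two).const_mul _)
    ((hneu_z.integrable one_le_two).const_mul _), integral_const_mul, integral_const_mul]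
  rfl

theorem ae_corIntegrand_eq [SFinite P] [SFinite (surfaceMeasure B)]
    (hdir : MemLp (fun p : Ω × E3 => us p.1 p.2) 2 (P.prod (surfaceMeasure B)))
    (hneu : MemLp (fun p : Ω × E3 => normalDeriv B (us p.1) p.2) 2 (P.prod (surfaceMeasure B)))
    (κ : ℝ) (x x' : E3) :
    ∀ᵐ q ∂(surfaceMeasure B).prod (surfaceMeasure B),
      ∫ ω, waveDensity κ B us x (ω, q.1) * conj (waveDensity κ B us x' (ω, q.2)) ∂P =
        corIntegrand κ B P us x x' q.1 q.2 := by
  have hsection := (ae_memLp_section two_ne_zero ENNReal.ofNat_ne_top hdir).and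
    (ae_memLp_section two_ne_zero ENNReal.ofNat_ne_top hneu)
  filter_upwards [Measure.quasiMeasurePreserving_fst.ae hsection,
    Measure.quasiMeasurePreserving_snd.ae hsection] with q hfst hsnd
  exact integral_sub_mul_mul_conj_sub_mul hfst.1 hfst.2 hsnd.1 hsnd.2
    (greenNormal κ B x q.1) (greenFun κ x q.1) (greenNormal κ B x' q.2) (greenFun κ x' q.2)

theorem IsLipschitzDomain.ae_eq_integral_waveDensity {κ : ℝ} {x : E3} (hB : IsLipschitzDomain B)
    (hκ : 0 < κ) (hus : ∀ᵐ ω ∂P, ∃ K ⊆ B, IsCompact K ∧ IsHelmholtzOn κ Kᶜ (us ω))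
    (hrad : ∀ᵐ ω ∂P, IsRadiating κ (us ω)) (hx : x ∉ closure B) :
    ∀ᵐ ω ∂P, us ω x = ∫ z, waveDensity κ B us x (ω, z) ∂surfaceMeasure B := by
  filter_upwards [hus, hrad] with ω ⟨K, hKB, hK, hwave⟩ hradω
  exact hB.eq_integral_of_isRadiating hκ hK hKB hwave hradω hx

end WaveDensity

end RandomScattering

end

open RandomScattering in
theorem mainTheorem2_general {Ω : Type*} [MeasurableSpace Ω] (P : Measure Ω)
    [IsProbabilityMeasure P] (κ : ℝ) (hκ : 0 < κ) (B : Set E3) (hB : IsLipschitzDomain B)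
    (us : Ω → E3 → ℂ)
    (hus : ∀ᵐ ω ∂P, ∃ K ⊆ B, IsCompact K ∧ IsHelmholtzOn κ Kᶜ (us ω))
    (hrad : ∀ᵐ ω ∂P, IsRadiating κ (us ω))
    (hdir : MemLp (fun p : Ω × E3 => us p.1 p.2) 2 (P.prod (surfaceMeasure B)))
    (hneu : MemLp (fun p : Ω × E3 => normalDeriv B (us p.1) p.2) 2
      (P.prod (surfaceMeasure B)))
    (x x' : E3) (hx : x ∉ closure B) (hx' : x' ∉ closure B) :
    MemLp (fun ω => us ω x) 2 P ∧
    (Integrable (meanIntegrand κ B P us x) (surfaceMeasure B) ∧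
      mean P us x = ∫ z, meanIntegrand κ B P us x z ∂(surfaceMeasure B)) ∧
    (Integrable (fun q : E3 × E3 => corIntegrand κ B P us x x' q.1 q.2)
        ((surfaceMeasure B).prod (surfaceMeasure B)) ∧
      cor P us us x x' =
        ∫ z, ∫ z', corIntegrand κ B P us x x' z z' ∂(surfaceMeasure B) ∂(surfaceMeasure B)) ∧
    cov P us x x' = cor P us us x x' - mean P us x * conj (mean P us x') ∧
    (var P us x : ℂ) = cov P us x x ∧
    cov P us x x = cor P us us x x - (‖mean P us x‖ : ℂ) ^ 2 := by
  have := hB.isFiniteMeasure_surfaceMeasure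
  have hdens := hB.memLp_waveDensity κ hdir hneu hx
  have hdens' := hB.memLp_waveDensity κ hdir hneu hx'
  have hrepr := hB.ae_eq_integral_waveDensity hκ hus hrad hx
  have hrepr' := hB.ae_eq_integral_waveDensity hκ hus hrad hx'
  have hwave : MemLp (fun ω => us ω x) 2 P :=
    (memLp_congr_ae hrepr).2 (memLp_integral_section hdens)
  have hwave' : MemLp (fun ω => us ω x') 2 P :=
    (memLp_congr_ae hrepr').2 (memLp_integral_section hdens')
  have hmean := ae_meanIntegrand_eq hdir hneu κ x
  have hcor := ae_corIntegrand_eq hdir hneu κ x x'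
  have hint : Integrable (waveDensity κ B us x) (P.prod (surfaceMeasure B)) :=
    hdens.integrable one_le_two
  refine ⟨hwave, ⟨hint.integral_prod_right.congr hmean, ?_⟩,
    ⟨(integrable_prod_mul_conj hdens hdens').integral_prod_right.congr hcor, ?_⟩,
    cov_eq_cor_sub hwave hwave', var_eq_cov us x, ?_⟩
  · rw [← integral_congr_ae hmean]
    exact (integral_congr_ae hrepr).trans (integral_integral_swap hint)
  · have hcor_iter := (Measure.ae_ae_of_ae_prod hcor).mono fun z hz => integral_congr_ae hz
    rw [← integral_congr_ae hcor_iter, integral_integral_integral_mul_conj hdens hdens']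
    refine integral_congr_ae ?_
    filter_upwards [hrepr, hrepr'] with ω hω hω'
    rw [hω, hω']
  · rw [cov_eq_cor_sub hwave hwave, Complex.mul_conj, Complex.normSq_eq_norm_sq, Complex.ofReal_pow]

open RandomScattering in
theorem mainTheorem2 {Ω : Type*} [MeasurableSpace Ω] (P : Measure Ω) [IsProbabilityMeasure P]
    (κ : ℝ) (hκ : 0 < κ) (d : E3) (hd : ‖d‖ = 1)
    -- the region `B` enclosed by the interface `T = ∂B`
    (B : Set E3) (hB : IsLipschitzDomain B)
    -- the random obstacle and its scattered wave
    (D : Ω → Set E3) (us : Ω → E3 → ℂ)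
    (hD : ∀ᵐ ω ∂P, IsLipschitzDomain (D ω))
    (hDB : ∀ᵐ ω ∂P, closure (D ω) ⊆ B)
    (hus : ∀ᵐ ω ∂P, IsScatteredWave κ d (D ω) (us ω))
    -- the Cauchy data on the interface have second moments
    (hdir : MemLp (fun p : Ω × E3 => us p.1 p.2) 2 (P.prod (surfaceMeasure B)))
    (hneu : MemLp (fun p : Ω × E3 => normalDeriv B (us p.1) p.2) 2
      (P.prod (surfaceMeasure B)))
    (x x' : E3) (hx : x ∉ closure B) (hx' : x' ∉ closure B) :
    -- the wave has second moments at `x`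
    MemLp (fun ω => us ω x) 2 P ∧
    -- mean
    (Integrable (meanIntegrand κ B P us x) (surfaceMeasure B) ∧
      mean P us x = ∫ z, meanIntegrand κ B P us x z ∂(surfaceMeasure B)) ∧
    -- correlation
    (Integrable (fun q : E3 × E3 => corIntegrand κ B P us x x' q.1 q.2)
        ((surfaceMeasure B).prod (surfaceMeasure B)) ∧
      cor P us us x x' =
        ∫ z, ∫ z', corIntegrand κ B P us x x' z z' ∂(surfaceMeasure B) ∂(surfaceMeasure B)) ∧
    -- covariance and variance
    cov P us x x' = cor P us us x x' - mean P us x * conj (mean P us x') ∧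
    (var P us x : ℂ) = cov P us x x ∧
    cov P us x x = cor P us us x x - (‖mean P us x‖ : ℂ) ^ 2 := by
  refine mainTheorem2_general P κ hκ B hB us ?_ (hus.mono fun _ h => h.radiation) hdir hneu
    x x' hx hx'
  filter_upwards [hDB, hus] with ω hsub hwave
  exact ⟨closure (D ω), hsub, Metric.isCompact_of_isClosed_isBounded isClosed_closure
    (hB.isBounded.subset hsub), hwave.isHelmholtzOn hd⟩
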